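/- For finite simple graphs $G$ and $J$, a copy of $J$ in $G$ is a (not necessarily induced, unlabeled) subgraph of $G$ isomorphic to $J$, and $N(G,J)$ is the number of copies of $J$ in $G$. Let $G_{n,p}$ be the random graph on $\{1,\dots,n\}$ containing each edge of $K_n$ with probability $p$, independently of other choices. Let $H$ be a finite simple graph with at least one edge and with $v_H:=|V(H)|\le n$. Let $p_c(H)=p_c(n,H)$ be the unique $p\in[0,1]$ for which $\Pr(G_{n,p}\text{ contains a copy of }H)=1/2$, and let $$p_E(H)=p_E(n,H)=\min\{p\in[0,1]:\ \mathbb{E}\,N(G_{n,p},I)\ge 1/2\ \text{ for every subgraph } I\subseteq H\}.$$ Theorem. There is a fixed (absolute) constant $K$ such that for every positive integer $n$ and every graph $H$ as above, if $p_E(H)<1/(3n)$, then $$p_c(H)<K\,p_E(H)\,\log_2 v_H.$$ -/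

import Mathlib

namespace KahnKalai

open MeasureTheory SimpleGraph

/-- The probability that the binomial random graph on `Fin n` with edge probability `p` contains a
copy of `H`, i.e. a (not necessarily induced) subgraph isomorphic to `H`. -/
noncomputable def containProb (n : ℕ) {V : Type*} (H : SimpleGraph V) (p : unitInterval) : ℝ :=
  (binomialRandom (Fin n) p).real {G | H.IsContained G}

/-- The expected number of (unlabelled) copies of `J` in the binomial random graph on `Fin n` with
edge probability `p`. -/
noncomputable def expCopies (n : ℕ) {W : Type*} (J : SimpleGraph W) (p : unitInterval) : ℝ :=
  ∫ G, (G.copyCount J : ℝ) ∂(binomialRandom (Fin n) p)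

/-- The threshold for `H`-containment: the number `p ∈ [0, 1]` at which the random graph contains a
copy of `H` with probability exactly `1 / 2`. If `H` has an edge and at most `n` vertices, then such
a `p` exists and is unique, see `existsUnique_containProb_eq_half` and `pc_spec`. -/
noncomputable def pc (n : ℕ) {V : Type*} (H : SimpleGraph V) : ℝ :=
  sInf {x : ℝ | ∃ p : unitInterval, (p : ℝ) = x ∧ containProb n H p = 1 / 2}

/-- The graphic expectation threshold of `H`: the least `p ∈ [0, 1]` for which every subgraph `I`
of `H` (spanning or not) has at least `1 / 2` expected copies in the random graph. If `H` has at
most `n` vertices, then the minimum is attained, see `isLeast_pE`. -/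
noncomputable def pE (n : ℕ) {V : Type*} (H : SimpleGraph V) : ℝ :=
  sInf {x : ℝ | ∃ p : unitInterval, (p : ℝ) = x ∧ ∀ I : H.Subgraph, 1 / 2 ≤ expCopies n I.coe p}

/-! ### The two thresholds are well defined -/

section WellDefined

lemma binomialRandom_real_singleton (n : ℕ) (p : unitInterval) (G : SimpleGraph (Fin n)) :
    (binomialRandom (Fin n) p).real {G} =
      (p : ℝ) ^ G.edgeSet.ncard * (1 - (p : ℝ)) ^ (n.choose 2 - G.edgeSet.ncard) := by
  simp [measureReal_def]

lemma measurableSet_graph (n : ℕ) (S : Set (SimpleGraph (Fin n))) : MeasurableSet S := by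
  have h1 : ∀ G : SimpleGraph (Fin n), MeasurableSet ({G} : Set (SimpleGraph (Fin n))) := by
    intro G
    have : ({G} : Set (SimpleGraph (Fin n))) = edgeSet ⁻¹' {G.edgeSet} := by
      ext G'; simp
    rw [this]
    exact measurable_edgeSet (measurableSet_singleton _)
  rw [← Set.biUnion_of_singleton S]
  exact S.toFinite.measurableSet_biUnion fun G _ => h1 G

instance (n : ℕ) : MeasurableSingletonClass (SimpleGraph (Fin n)) :=
  ⟨fun _ => measurableSet_graph n _⟩

lemma integral_binomialRandom (n : ℕ) (p : unitInterval) (f : SimpleGraph (Fin n) → ℝ) :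
    ∫ G, f G ∂(binomialRandom (Fin n) p) = ∑ G : SimpleGraph (Fin n),
      (p : ℝ) ^ G.edgeSet.ncard * (1 - (p : ℝ)) ^ (n.choose 2 - G.edgeSet.ncard) * f G := by
  rw [integral_fintype (by exact Integrable.of_finite)]
  simp [binomialRandom_real_singleton]

lemma continuous_expCopies (n : ℕ) {W : Type*} (J : SimpleGraph W) :
    Continuous (expCopies n J) := by
  unfold expCopies
  simp only [integral_binomialRandom]
  fun_prop

lemma isLeast_pE (n : ℕ) {V : Type*} [Fintype V] (H : SimpleGraph V) (hn : Fintype.card V ≤ n) :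
    IsLeast {x : ℝ | ∃ p : unitInterval, (p : ℝ) = x ∧
      ∀ I : H.Subgraph, 1 / 2 ≤ expCopies n I.coe p} (pE n H) := by
  have hcl : IsClosed {p : unitInterval | ∀ I : H.Subgraph, 1 / 2 ≤ expCopies n I.coe p} := by
    simp only [Set.ofPred_forall]
    exact isClosed_iInter fun I => isClosed_le continuous_const (continuous_expCopies n I.coe)
  have hne : {p : unitInterval | ∀ I : H.Subgraph, 1 / 2 ≤ expCopies n I.coe p}.Nonempty := by
    refine ⟨1, fun I => ?_⟩
    have hI : I.coe.IsContained (⊤ : SimpleGraph (Fin n)) := by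
      have f : V ↪ Fin n := (Function.Embedding.nonempty_of_card_le (by simpa using hn)).some
      exact ⟨⟨⟨fun v => f v, fun {a b} h => by simpa using fun h' => h.ne (Subtype.ext h')⟩,
        fun a b h => Subtype.ext (f.injective h)⟩⟩
    have : (1 : ℝ) ≤ ((⊤ : SimpleGraph (Fin n)).copyCount I.coe : ℝ) := by
      exact_mod_cast copyCount_pos.2 hI
    simp only [expCopies, binomialRandom_one, integral_dirac]
    linarith
  obtain ⟨p, hp, hmin⟩ := hcl.isCompact.exists_isLeast hne
  have h : IsLeast {x : ℝ | ∃ p : unitInterval, (p : ℝ) = x ∧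
      ∀ I : H.Subgraph, 1 / 2 ≤ expCopies n I.coe p} (p : ℝ) := by
    refine ⟨⟨p, rfl, hp⟩, ?_⟩
    rintro x ⟨q, rfl, hq⟩
    exact hmin hq
  have he : pE n H = p := h.csInf_eq
  rw [he]
  exact h

/-- Monotonicity in `p` of the probability of an increasing family of subsets of a finite set. -/
lemma sum_upper_mono {α : Type*} [DecidableEq α] (u : Finset α) {p q : ℝ} (hp : 0 ≤ p)
    (hpq : p ≤ q) (hq : q ≤ 1) :
    ∀ f : Finset α → ℝ, Monotone f →
      ∑ S ∈ u.powerset, p ^ S.card * (1 - p) ^ (u.card - S.card) * f S ≤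
        ∑ S ∈ u.powerset, q ^ S.card * (1 - q) ^ (u.card - S.card) * f S := by
  induction u using Finset.induction_on with
  | empty => intro f _; simp
  | insert a s ha ih =>
    intro f hf
    have key : ∀ r : ℝ, ∑ S ∈ (insert a s).powerset,
        r ^ S.card * (1 - r) ^ ((insert a s).card - S.card) * f S =
        (1 - r) * ∑ S ∈ s.powerset, r ^ S.card * (1 - r) ^ (s.card - S.card) * f S +
        r * ∑ S ∈ s.powerset, r ^ S.card * (1 - r) ^ (s.card - S.card) * f (insert a S) := by
      intro r
      rw [Finset.sum_powerset_insert ha, Finset.mul_sum, Finset.mul_sum]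
      congr 1
      · refine Finset.sum_congr rfl fun S hS => ?_
        have hc := Finset.card_le_card (Finset.mem_powerset.1 hS)
        rw [Finset.card_insert_of_notMem ha, Nat.succ_sub hc, pow_succ]
        ring
      · refine Finset.sum_congr rfl fun S hS => ?_
        have haS : a ∉ S := fun h => ha (Finset.mem_powerset.1 hS h)
        rw [Finset.card_insert_of_notMem ha, Finset.card_insert_of_notMem haS,
          Nat.add_sub_add_right, pow_succ]
        ring
    rw [key, key]
    have h1 := ih f hf
    have h2 := ih (fun S => f (insert a S))
      (fun S T h => hf (Finset.insert_subset_insert a h))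
    have h3 : ∑ S ∈ s.powerset, q ^ S.card * (1 - q) ^ (s.card - S.card) * f S ≤
        ∑ S ∈ s.powerset, q ^ S.card * (1 - q) ^ (s.card - S.card) * f (insert a S) := by
      refine Finset.sum_le_sum fun S _ => mul_le_mul_of_nonneg_left (hf (Finset.subset_insert a S)) ?_
      have : 0 ≤ q := hp.trans hpq
      have : 0 ≤ 1 - q := by linarith
      positivity
    nlinarith [mul_le_mul_of_nonneg_left h1 (by linarith : 0 ≤ 1 - p),
      mul_le_mul_of_nonneg_left h2 hp, mul_le_mul_of_nonneg_left h3 (by linarith : 0 ≤ q - p)]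

open Classical in
lemma containProb_eq (n : ℕ) {V : Type*} (H : SimpleGraph V) (p : unitInterval) :
    containProb n H p = ∑ G : SimpleGraph (Fin n),
      (p : ℝ) ^ G.edgeSet.ncard * (1 - (p : ℝ)) ^ (n.choose 2 - G.edgeSet.ncard) *
        if H.IsContained G then 1 else 0 := by
  rw [← integral_binomialRandom n p (fun G => if H.IsContained G then 1 else 0), containProb,
    ← integral_indicator_one (measurableSet_graph n _)]
  rfl

open Classical in
lemma containProb_eq' (n : ℕ) {V : Type*} (H : SimpleGraph V) (p : unitInterval) :
    containProb n H p = ∑ S ∈ (⊤ : SimpleGraph (Fin n)).edgeFinset.powerset,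
      (p : ℝ) ^ S.card *
        (1 - (p : ℝ)) ^ ((⊤ : SimpleGraph (Fin n)).edgeFinset.card - S.card) *
        if H.IsContained (fromEdgeSet (S : Set (Sym2 (Fin n)))) then 1 else 0 := by
  rw [containProb_eq]
  refine Finset.sum_bij' (fun G _ => G.edgeFinset)
    (fun S _ => fromEdgeSet (S : Set (Sym2 (Fin n)))) ?_ ?_ ?_ ?_ ?_
  · intro G _
    exact Finset.mem_powerset.2 (edgeFinset_mono le_top)
  · simp
  · intro G _
    simp
  · intro S hS
    have hS' := Finset.mem_powerset.1 hS
    ext e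
    simp only [mem_edgeFinset, edgeSet_fromEdgeSet, Set.mem_sdiff, Finset.mem_coe]
    refine ⟨fun h => h.1, fun h => ⟨h, ?_⟩⟩
    have := hS' h
    simpa using this
  · intro G _
    have h1 : G.edgeSet.ncard = G.edgeFinset.card := by
      rw [← coe_edgeFinset, Set.ncard_coe_finset]
    rw [h1, card_edgeFinset_top_eq_card_choose_two]
    simp

lemma monotone_containProb (n : ℕ) {V : Type*} (H : SimpleGraph V) :
    Monotone (containProb n H) := by
  classical
  intro p q hpq
  rw [containProb_eq', containProb_eq']
  refine sum_upper_mono _ p.2.1 hpq q.2.2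
    (fun S : Finset (Sym2 (Fin n)) =>
      if H.IsContained (fromEdgeSet (S : Set (Sym2 (Fin n)))) then 1 else 0) ?_
  intro S T hST
  have hle : fromEdgeSet (S : Set (Sym2 (Fin n))) ≤ fromEdgeSet (T : Set (Sym2 (Fin n))) :=
    fromEdgeSet_mono (by exact_mod_cast hST)
  by_cases h : H.IsContained (fromEdgeSet (S : Set (Sym2 (Fin n))))
  · simp [h, h.mono_right hle]
  · simp only [h, if_false]
    split_ifs <;> norm_num

lemma existsUnique_containProb_eq_half (n : ℕ) {V : Type*} [Fintype V] (H : SimpleGraph V)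
    (hn : Fintype.card V ≤ n) (hH : H ≠ ⊥) :
    ∃! p : unitInterval, containProb n H p = 1 / 2 := by
  classical
  let P : Polynomial ℝ := ∑ G : SimpleGraph (Fin n),
    Polynomial.X ^ G.edgeSet.ncard * (1 - Polynomial.X) ^ (n.choose 2 - G.edgeSet.ncard) *
      Polynomial.C (if H.IsContained G then 1 else 0)
  have hP : ∀ p : unitInterval, containProb n H p = P.eval (p : ℝ) := by
    intro p
    rw [containProb_eq]
    simp only [P, Polynomial.eval_finsetSum, Polynomial.eval_mul, Polynomial.eval_pow,
      Polynomial.eval_X, Polynomial.eval_sub, Polynomial.eval_one, Polynomial.eval_C]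
  have hcont : Continuous (containProb n H) := by
    have : containProb n H = fun p : unitInterval => P.eval (p : ℝ) := funext hP
    rw [this]
    exact P.continuous.comp continuous_subtype_val
  have h0 : containProb n H 0 = 0 := by
    have : ¬ H.IsContained (⊥ : SimpleGraph (Fin n)) := by
      rintro ⟨f⟩
      obtain ⟨a, b, hab⟩ := SimpleGraph.ne_bot_iff_exists_adj.1 hH
      exact f.toHom.map_adj hab
    simp [containProb, measureReal_def, Measure.dirac_apply' _ (measurableSet_graph n _), this]
  have h1 : containProb n H 1 = 1 := by
    have : H.IsContained (⊤ : SimpleGraph (Fin n)) := by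
      have f : V ↪ Fin n := (Function.Embedding.nonempty_of_card_le (by simpa using hn)).some
      exact ⟨⟨⟨fun v => f v, fun {a b} h => by simpa using h.ne⟩, f.injective⟩⟩
    simp [containProb, measureReal_def, Measure.dirac_apply' _ (measurableSet_graph n _), this]
  have hmem : (1 / 2 : ℝ) ∈ Set.Icc (containProb n H 0) (containProb n H 1) := by
    rw [h0, h1]; constructor <;> norm_num
  obtain ⟨p, hp⟩ := intermediate_value_univ 0 1 hcont hmem
  have hlt : ∀ a b : unitInterval, containProb n H a = 1 / 2 → containProb n H b = 1 / 2 →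
      ¬ a < b := by
    intro a b ha hb hab
    have hroots : Set.Infinite {x : ℝ | (P - Polynomial.C (1 / 2)).IsRoot x} := by
      refine (Set.Icc_infinite (show (a : ℝ) < b from hab)).mono fun x hx => ?_
      let c : unitInterval := ⟨x, a.2.1.trans hx.1, hx.2.trans b.2.2⟩
      have e1 : containProb n H a ≤ containProb n H c := monotone_containProb n H hx.1
      have e2 : containProb n H c ≤ containProb n H b := monotone_containProb n H hx.2
      have e3 : containProb n H c = P.eval x := hP c
      simp only [Set.mem_ofPred_eq, Polynomial.IsRoot, Polynomial.eval_sub, Polynomial.eval_C]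
      linarith
    have hz := Polynomial.eq_zero_of_infinite_isRoot _ hroots
    have := congrArg (Polynomial.eval (((0 : unitInterval) : ℝ))) hz
    rw [Polynomial.eval_sub, ← hP, h0] at this
    norm_num at this
  refine ⟨p, hp, fun q hq => ?_⟩
  exact le_antisymm (not_lt.1 (hlt p q hp hq)) (not_lt.1 (hlt q p hq hp))

/-- `pc n H` lies in `[0, 1]`, and it is the only point there at which the containment probability
is `1 / 2`. -/
lemma pc_spec (n : ℕ) {V : Type*} [Fintype V] (H : SimpleGraph V)
    (hn : Fintype.card V ≤ n) (hH : H ≠ ⊥) (p : unitInterval) :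
    containProb n H p = 1 / 2 ↔ (p : ℝ) = pc n H := by
  obtain ⟨q, hq, huniq⟩ := existsUnique_containProb_eq_half n H hn hH
  have hset : {x : ℝ | ∃ p : unitInterval, (p : ℝ) = x ∧ containProb n H p = 1 / 2} = {(q : ℝ)} := by
    ext x
    constructor
    · rintro ⟨r, rfl, hr⟩
      rw [huniq r hr]
      rfl
    · rintro rfl
      exact ⟨q, rfl, hq⟩
  have hpc : pc n H = q := by rw [pc, hset, csInf_singleton]
  rw [hpc]
  refine ⟨fun h => by rw [huniq p h], fun h => ?_⟩
  rw [Subtype.ext h]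
  exact hq

end WellDefined

end KahnKalai

/-! Write p = p_E(H) and x = np < 1/3. The uniformly random embedded copy of H is O(p)-spread: a set
S of edges lies in it with probability at most (5400p)^|S| (`card_filter_embedding_le`). For spread
families, the minimum-fragment argument (`spread_fail_le`) shows that a union of k = O(log v_H)
independent random graphs of density O(p) contains a member with probability at least 2/3.

Spreadness reduces to counting copies in H of the graph I formed by S. The lower bounds on expected
counts enter only through automorphisms: if J is contained in H then |Aut J| ≤ 2 n^{v_J} p^{e_J}
(`card_aut_le_of_isContained`). No cycle satisfies this when x ≤ 1/3, so H is a forest. If m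
components are isomorphic to D, of order s, their disjoint union has at least m!|Aut D|^m
automorphisms, whence m|Aut D| ≤ 6n x^{s-1} (`card_isoClass_mul_card_aut_le`).

Copies in H of a tree T on t vertices are summed over the components D of H. With weight 1/(m_D|Aut
D|), the copies in components of order t+r total at most the number of labelled trees extending T
divided by r!, hence at most (t+r)^r/r! ≤ e^{t+r} (`sum_card_copy_div_le`). Undoing the weights
leaves 6n x^{t-1} e^t (ex)^r, a convergent geometric series in r because ex < 1, and so a bound
n(600x)^{t-1} (`card_copy_le_pow`). Multiplying over the components of I gives the count for forests
(`card_copy_le`). -/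

namespace KahnKalai

open MeasureTheory SimpleGraph

/-! ### Random subsets of a finite set -/

section BiasedSum

variable {α : Type*}

/-- The expectation of `f S` for a random subset `S` of `u` containing each element independently
with probability `q`. -/
noncomputable def biasedSum (u : Finset α) (q : ℝ) (f : Finset α → ℝ) : ℝ :=
  ∑ S ∈ u.powerset, q ^ S.card * (1 - q) ^ (u.card - S.card) * f S

lemma biasedSum_empty (q : ℝ) (f : Finset α → ℝ) : biasedSum ∅ q f = f ∅ := by
  simp [biasedSum]

lemma biasedSum_insert [DecidableEq α] {a : α} {s : Finset α} (ha : a ∉ s) (q : ℝ) (f : Finset α → ℝ) :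
    biasedSum (insert a s) q f =
      (1 - q) * biasedSum s q f + q * biasedSum s q (fun S => f (insert a S)) := by
  unfold biasedSum
  rw [Finset.sum_powerset_insert ha, Finset.mul_sum, Finset.mul_sum]
  congr 1
  · refine Finset.sum_congr rfl fun S hS => ?_
    have hc := Finset.card_le_card (Finset.mem_powerset.1 hS)
    rw [Finset.card_insert_of_notMem ha, Nat.succ_sub hc, pow_succ]
    ring
  · refine Finset.sum_congr rfl fun S hS => ?_
    have haS : a ∉ S := fun h => ha (Finset.mem_powerset.1 hS h)
    rw [Finset.card_insert_of_notMem ha, Finset.card_insert_of_notMem haS,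
      Nat.add_sub_add_right, pow_succ]
    ring

lemma biasedSum_add (u : Finset α) (q : ℝ) (f g : Finset α → ℝ) :
    biasedSum u q (fun S => f S + g S) = biasedSum u q f + biasedSum u q g := by
  simp [biasedSum, mul_add, Finset.sum_add_distrib]

lemma biasedSum_mul (u : Finset α) (q c : ℝ) (f : Finset α → ℝ) :
    biasedSum u q (fun S => c * f S) = c * biasedSum u q f := by
  simp only [biasedSum, Finset.mul_sum]
  exact Finset.sum_congr rfl fun S _ => by ring

lemma biasedSum_mono (u : Finset α) {q : ℝ} (h0 : 0 ≤ q) (h1 : q ≤ 1) {f g : Finset α → ℝ}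
    (h : ∀ S ⊆ u, f S ≤ g S) : biasedSum u q f ≤ biasedSum u q g := by
  have : 0 ≤ 1 - q := by linarith
  exact Finset.sum_le_sum fun S hS =>
    mul_le_mul_of_nonneg_left (h S (Finset.mem_powerset.1 hS)) (by positivity)

lemma biasedSum_const [DecidableEq α] (u : Finset α) (q c : ℝ) : biasedSum u q (fun _ => c) = c := by
  induction u using Finset.induction_on with
  | empty => simp [biasedSum_empty]
  | insert a s ha ih => rw [biasedSum_insert ha, ih]; ring

/-- An element is missed by two independent random sets with probability (1 - q)(1 - r). This allows
the rounds of the spread argument to be exposed one at a time. -/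
lemma biasedSum_union [DecidableEq α] (u : Finset α) (q r : ℝ) (f : Finset α → ℝ) :
    biasedSum u q (fun S => biasedSum u r fun T => f (S ∪ T)) =
      biasedSum u (1 - (1 - q) * (1 - r)) f := by
  induction u using Finset.induction_on generalizing f with
  | empty => simp [biasedSum_empty]
  | insert a s ha ih =>
    simp only [biasedSum_insert ha, biasedSum_add, biasedSum_mul, Finset.insert_union,
      Finset.union_insert, Finset.insert_idem]
    rw [ih, ih (fun S => f (insert a S))]
    ring

lemma biasedSum_superset [DecidableEq α] {u A : Finset α} (hA : A ⊆ u) (q : ℝ) :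
    biasedSum u q (fun S => if A ⊆ S then 1 else 0) = q ^ A.card := by
  induction u using Finset.induction_on generalizing A with
  | empty => simp [biasedSum_empty, Finset.subset_empty.1 hA]
  | insert a s ha ih =>
    rw [biasedSum_insert ha]
    by_cases haA : a ∈ A
    · have h1 : biasedSum s q (fun S => if A ⊆ S then 1 else 0) = 0 := by
        refine Finset.sum_eq_zero fun S hS => ?_
        have h : ¬ A ⊆ S := fun h => ha (Finset.mem_powerset.1 hS (h haA))
        simp [h]
      have h2 : ∀ S, A ⊆ insert a S ↔ A.erase a ⊆ S := fun S => Finset.subset_insert_iff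
      simp only [h1, h2]
      rw [ih (Finset.subset_insert_iff.1 hA), ← Finset.card_erase_add_one haA, pow_succ]
      ring
    · have h2 : ∀ S, A ⊆ insert a S ↔ A ⊆ S := fun S => Finset.subset_insert_iff_of_notMem haA
      simp only [h2]
      rw [ih ((Finset.subset_insert_iff_of_notMem haA).1 hA)]
      ring

end BiasedSum

/-! ### Spread families and minimum fragments -/

section Spread

variable {α ι : Type*} [DecidableEq α]

/-- For every `w ∈ Ω` and every set `W` there is a minimal fragment of the family at `(w, W)`. -/
lemma exists_fragment (Ω : Finset ι) (A : ι → Finset α) (W : Finset α) {w : ι} (hw : w ∈ Ω) :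
    ∃ T : Finset α, T ⊆ A w ∧ Disjoint W T ∧ (∃ v ∈ Ω, A v ⊆ W ∪ T) ∧
      ∀ v ∈ Ω, A v ⊆ W ∪ T → T ⊆ A v := by
  classical
  -- The fragment is `A v \ W` of least size; any `A v'` inside `W ∪ T` has `A v' \ W ⊆ T`, and
  -- minimality forces equality.
  obtain ⟨v, hv, hmin⟩ := Finset.exists_min_image (Ω.filter fun v => A v ⊆ W ∪ A w)
    (fun v => (A v \ W).card) ⟨w, by simp [hw]⟩
  rw [Finset.mem_filter] at hv
  have hT : A v \ W ⊆ A w := sdiff_le_iff.2 hv.2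
  refine ⟨A v \ W, hT, Finset.disjoint_sdiff, ⟨v, hv.1, ?_⟩, ?_⟩
  · rw [Finset.union_sdiff_self_eq_union]
    exact Finset.subset_union_right
  · intro v' hv' hsub
    have h1 : A v' \ W ⊆ A v \ W := sdiff_le_iff.2 hsub
    have h2 := hmin v' (Finset.mem_filter.2
      ⟨hv', hsub.trans (Finset.union_subset_union_right hT)⟩)
    rw [← Finset.eq_of_subset_of_card_le h1 h2]
    exact Finset.sdiff_subset

/-- The expected weight of the large minimal fragments is small. -/
lemma biasedSum_fragments_le (u : Finset α) (Ω : Finset ι) (A : ι → Finset α) {l : ℕ}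
    (hA : ∀ w ∈ Ω, A w ⊆ u ∧ (A w).card ≤ l) {p : ℝ} (hp : 0 ≤ p) (hq : 64 * p ≤ 1)
    (F : Finset α → Finset (Finset α))
    (hF : ∀ W, ∀ T ∈ F W, l < 2 * T.card ∧ Disjoint W T ∧ (∃ v ∈ Ω, A v ⊆ W ∪ T) ∧
      ∀ v ∈ Ω, A v ⊆ W ∪ T → T ⊆ A v) :
    biasedSum u (64 * p) (fun W => ∑ T ∈ F W, p ^ T.card) ≤ (1 / 4) ^ l := by
  classical
  set q := 64 * p with hqdef
  have hq0 : 0 ≤ q := by positivity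
  have hq1 : 0 ≤ 1 - q := by linarith
  have hTu : ∀ W, ∀ T ∈ F W, T ⊆ u := fun W T hT => by
    obtain ⟨-, -, ⟨v, hv, hvT⟩, h⟩ := hF W T hT
    exact (h v hv hvT).trans (hA v hv).1
  let μ : Finset α → ℝ := fun S => q ^ S.card * (1 - q) ^ (u.card - S.card)
  have hμ : ∀ S, 0 ≤ μ S := fun S => by positivity
  let K : Finset α → Finset (Finset α) := fun Z =>
    u.powerset.filter fun T => T ⊆ Z ∧ T ∈ F (Z \ T)
  calc biasedSum u q (fun W => ∑ T ∈ F W, p ^ T.card)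
      = ∑ W ∈ u.powerset, ∑ T ∈ F W, μ W * p ^ T.card := by
        simp only [biasedSum, Finset.mul_sum, μ]
    -- As p = q/64, absorbing T into the random set turns p^|T| into 64^{-|T|}; the factor (1 -
    -- q)^|T| ≤ 1 is dropped.
    _ ≤ ∑ W ∈ u.powerset, ∑ T ∈ F W, μ (W ∪ T) * (1 / 64) ^ T.card := by
        refine Finset.sum_le_sum fun W hW => Finset.sum_le_sum fun T hT => ?_
        have hcard : (W ∪ T).card = W.card + T.card :=
          Finset.card_union_of_disjoint (hF W T hT).2.1
        have hle : W.card + T.card ≤ u.card := by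
          rw [← hcard]
          exact Finset.card_le_card
            (Finset.union_subset (Finset.mem_powerset.1 hW) (hTu W T hT))
        have hsplit : u.card - W.card = (u.card - (W.card + T.card)) + T.card := by omega
        have hpq : p = q * (1 / 64) := by rw [hqdef]; ring
        simp only [μ]
        rw [hcard, hsplit, pow_add, pow_add]
        have h1 : (1 - q) ^ T.card ≤ 1 := pow_le_one₀ hq1 (by linarith)
        have h2 : p ^ T.card = q ^ T.card * (1 / 64) ^ T.card := by rw [← mul_pow, ← hpq]
        rw [h2]
        calc q ^ W.card * ((1 - q) ^ (u.card - (W.card + T.card)) * (1 - q) ^ T.card) *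
              (q ^ T.card * (1 / 64) ^ T.card)
            = (q ^ W.card * q ^ T.card * (1 - q) ^ (u.card - (W.card + T.card)) *
              (1 / 64) ^ T.card) * (1 - q) ^ T.card := by ring
          _ ≤ (q ^ W.card * q ^ T.card * (1 - q) ^ (u.card - (W.card + T.card)) *
              (1 / 64) ^ T.card) * 1 := mul_le_mul_of_nonneg_left h1 (by positivity)
          _ = _ := by ring
    _ ≤ ∑ Z ∈ u.powerset, ∑ T ∈ K Z, μ Z * (1 / 64) ^ T.card := by
        rw [Finset.sum_sigma', Finset.sum_sigma']
        -- Disjointness of W and T makes this map injective: W is recovered as the difference.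
        let g : (_ : Finset α) × Finset α → (_ : Finset α) × Finset α := fun x => ⟨x.1 ∪ x.2, x.2⟩
        have hback : ∀ x ∈ u.powerset.sigma F, (x.1 ∪ x.2) \ x.2 = x.1 := fun x hx => by
          have := (hF x.1 x.2 (Finset.mem_sigma.1 hx).2).2.1
          rw [Finset.union_sdiff_right, Finset.sdiff_eq_self_of_disjoint this]
        have hinj : Set.InjOn g (u.powerset.sigma F) := by
          rintro ⟨W, T⟩ hx ⟨W', T'⟩ hy hxy
          have h1 := hback _ hx
          have h2 := hback _ hy
          simp only [g, Sigma.mk.injEq, heq_eq_eq] at hxy h1 h2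
          rw [hxy.1, hxy.2] at h1
          rw [h2] at h1
          rw [h1, hxy.2]
        rw [← Finset.sum_image (f := fun x : (_ : Finset α) × Finset α =>
          μ x.1 * (1 / 64) ^ x.2.card) hinj]
        refine Finset.sum_le_sum_of_subset_of_nonneg ?_ fun x _ _ =>
          mul_nonneg (hμ _) (by positivity)
        intro y hy
        obtain ⟨x, hx, rfl⟩ := Finset.mem_image.1 hy
        obtain ⟨hx1, hx2⟩ := Finset.mem_sigma.1 hx
        have hT := hTu x.1 x.2 hx2
        refine Finset.mem_sigma.2 ⟨Finset.mem_powerset.2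
          (Finset.union_subset (Finset.mem_powerset.1 hx1) hT), ?_⟩
        simp only [K, g, Finset.mem_filter, Finset.mem_powerset]
        rw [hback x hx]
        exact ⟨hT, Finset.subset_union_right, hx2⟩
    _ ≤ ∑ Z ∈ u.powerset, μ Z * (1 / 4) ^ l := by
        refine Finset.sum_le_sum fun Z hZ => ?_
        rw [← Finset.mul_sum]
        refine mul_le_mul_of_nonneg_left ?_ (hμ Z)
        -- Once Z is fixed, all fragments lie in a single `A v ⊆ Z`, so there are at most 2^l of
        -- them, each of weight at most 64^{-l/2} = 8^{-l}.
        have hmem : ∀ T ∈ K Z, l < 2 * T.card ∧ (∃ v ∈ Ω, A v ⊆ Z) ∧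
            ∀ v ∈ Ω, A v ⊆ Z → T ⊆ A v := by
          intro T hT
          simp only [K, Finset.mem_filter] at hT
          have := hF _ T hT.2.2
          rw [Finset.sdiff_union_of_subset hT.2.1] at this
          exact ⟨this.1, this.2.2⟩
        rcases (K Z).eq_empty_or_nonempty with he | ⟨T₀, hT₀⟩
        · rw [he, Finset.sum_empty]; positivity
        obtain ⟨v, hv, hvZ⟩ := (hmem T₀ hT₀).2.1
        calc ∑ T ∈ K Z, (1 / 64 : ℝ) ^ T.card ≤ ∑ T ∈ K Z, (1 / 8 : ℝ) ^ l := by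
              refine Finset.sum_le_sum fun T hT => ?_
              rw [show (1 / 64 : ℝ) = (1 / 8) ^ 2 by norm_num, ← pow_mul]
              exact pow_le_pow_of_le_one (by norm_num) (by norm_num) (hmem T hT).1.le
          _ ≤ (2 : ℝ) ^ l * (1 / 8) ^ l := by
              rw [Finset.sum_const, nsmul_eq_mul]
              refine mul_le_mul_of_nonneg_right ?_ (by positivity)
              have h1 : (K Z).card ≤ (A v).powerset.card := Finset.card_le_card fun T hT =>
                Finset.mem_powerset.2 ((hmem T hT).2.2 v hv hvZ)
              rw [Finset.card_powerset] at h1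
              have h2 := h1.trans (Nat.pow_le_pow_right (by norm_num) (hA v hv).2)
              exact_mod_cast h2
          _ = (1 / 4) ^ l := by rw [← mul_pow]; norm_num
    _ = (1 / 4) ^ l := biasedSum_const u q _

/-- A spread family of sets of size less than `2 ^ k` contains a subset of a random set which is
the union of `k` independent random sets of constant density times the spread parameter. -/
theorem spread_fail_le (u : Finset α) {p : ℝ} (hp : 0 ≤ p) (hq : 64 * p ≤ 1) {N : ℝ} (hN : 0 ≤ N)
    (k : ℕ) : ∀ (l : ℕ), l < 2 ^ k → ∀ (Ω : Finset ι) (A : ι → Finset α)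
    [∀ W : Finset α, Decidable (∃ w ∈ Ω, A w ⊆ W)],
    (∀ w ∈ Ω, A w ⊆ u ∧ (A w).card ≤ l) →
    (∀ R : Finset α, R.Nonempty → ((Ω.filter fun w => R ⊆ A w).card : ℝ) ≤ N * p ^ R.card) →
    (Ω.card : ℝ) * biasedSum u (1 - (1 - 64 * p) ^ k)
      (fun W => if ∃ w ∈ Ω, A w ⊆ W then 0 else 1) ≤ N * ∑ j ∈ Finset.Icc 1 l, (1 / 4 : ℝ) ^ j := by
  have hzero : ∀ (Ω : Finset ι) (A : ι → Finset α) (q : ℝ)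
      [∀ W : Finset α, Decidable (∃ w ∈ Ω, A w ⊆ W)],
      (∀ w ∈ Ω, A w ⊆ u ∧ (A w).card ≤ 0) →
      (Ω.card : ℝ) * biasedSum u q (fun W => if ∃ w ∈ Ω, A w ⊆ W then 0 else 1) ≤ 0 := by
    intro Ω A q _ hA
    rcases Ω.eq_empty_or_nonempty with rfl | ⟨w, hw⟩
    · simp
    · have h : ∀ W, ∃ w ∈ Ω, A w ⊆ W := fun W => ⟨w, hw, by
        rw [Finset.card_eq_zero.1 (Nat.le_zero.1 (hA w hw).2)]; simp⟩
      simp [h, biasedSum]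
  have hq0 : 0 ≤ 1 - 64 * p := by linarith
  induction k with
  | zero =>
    intro l hl Ω A _ hA _
    obtain rfl : l = 0 := by simpa using hl
    simpa using hzero Ω A _ hA
  | succ k ih =>
    intro l hl Ω A _ hA hsp
    rcases Nat.eq_zero_or_pos l with rfl | hl0
    · simpa using hzero Ω A _ hA
    classical
    have hex : ∀ (W : Finset α) (w : ι), ∃ T : Finset α, w ∈ Ω → (T ⊆ A w ∧ Disjoint W T ∧
        (∃ v ∈ Ω, A v ⊆ W ∪ T) ∧ ∀ v ∈ Ω, A v ⊆ W ∪ T → T ⊆ A v) := fun W w => by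
      by_cases hw : w ∈ Ω
      · obtain ⟨T, hT⟩ := exists_fragment Ω A W hw
        exact ⟨T, fun _ => hT⟩
      · exact ⟨∅, fun h => absurd h hw⟩
    choose T hT using hex
    -- Indices with a fragment larger than l/2 are given up. The other fragments form a family of
    -- sets of size at most l/2, left to the remaining k rounds; it is spread with the same N, since
    -- fragments are subsets of the original sets. This is why N is a parameter separate from
    -- `Ω.card`.
    let big : Finset α → Finset ι := fun W => Ω.filter fun w => l < 2 * (T W w).card
    let small : Finset α → Finset ι := fun W => Ω.filter fun w => ¬ l < 2 * (T W w).card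
    let F : Finset α → Finset (Finset α) := fun W => (big W).image (T W)
    -- Union bound over the distinct large fragments, each contained in few sets by spreadness.
    have hlost : ∀ W, ((big W).card : ℝ) ≤ N * ∑ R ∈ F W, p ^ R.card := by
      intro W
      have h1 : (big W).card ≤ ∑ R ∈ F W, (Ω.filter fun w => R ⊆ A w).card := by
        rw [Finset.card_eq_sum_card_image (T W) (big W)]
        refine Finset.sum_le_sum fun R hR => Finset.card_le_card fun w hw => ?_
        simp only [big, Finset.mem_filter] at hw ⊢
        exact ⟨hw.1.1, hw.2 ▸ (hT W w hw.1.1).1⟩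
      refine (Nat.cast_le.2 h1).trans ?_
      rw [Nat.cast_sum, Finset.mul_sum]
      refine Finset.sum_le_sum fun R hR => hsp R ?_
      obtain ⟨w, hw, rfl⟩ := Finset.mem_image.1 hR
      have := (Finset.mem_filter.1 hw).2
      exact Finset.card_pos.1 (by omega)
    have hfrag := biasedSum_fragments_le u Ω A hA hp hq F (by
      intro W R hR
      obtain ⟨w, hw, rfl⟩ := Finset.mem_image.1 hR
      obtain ⟨hw, hw'⟩ := Finset.mem_filter.1 hw
      exact ⟨hw', (hT W w hw).2⟩)
    have hsmall : ∀ W, ((small W).card : ℝ) * biasedSum u (1 - (1 - 64 * p) ^ k)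
        (fun W' => if ∃ w ∈ small W, T W w ⊆ W' then 0 else 1) ≤
          N * ∑ j ∈ Finset.Icc 1 (l / 2), (1 / 4 : ℝ) ^ j := by
      intro W
      refine ih (l / 2) (by rw [pow_succ] at hl; omega) (small W) (T W) ?_ ?_
      · intro w hw
        obtain ⟨hw, hw'⟩ := Finset.mem_filter.1 hw
        exact ⟨(hT W w hw).1.trans (hA w hw).1, by omega⟩
      · intro R hR
        refine le_trans (Nat.cast_le.2 (Finset.card_le_card fun w hw => ?_)) (hsp R hR)
        simp only [small, Finset.mem_filter] at hw ⊢
        exact ⟨hw.1.1, hw.2.trans (hT W w hw.1.1).1⟩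
    have hr1 : (1 - 64 * p) ^ k ≤ 1 := pow_le_one₀ hq0 (by linarith)
    have hr0 : 0 ≤ (1 - 64 * p) ^ k := pow_nonneg hq0 k
    have hpt : ∀ W W', (Ω.card : ℝ) * (if ∃ w ∈ Ω, A w ⊆ W ∪ W' then 0 else 1) ≤
        ((big W).card : ℝ) +
          (small W).card * (if ∃ w ∈ small W, T W w ⊆ W' then 0 else 1) := by
      intro W W'
      by_cases h : ∃ w ∈ Ω, A w ⊆ W ∪ W'
      · rw [if_pos h, mul_zero]
        split_ifs <;> positivity
      · have h' : ¬ ∃ w ∈ small W, T W w ⊆ W' := by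
          rintro ⟨w, hw, hwT⟩
          obtain ⟨v, hv, hv'⟩ := (hT W w (Finset.mem_filter.1 hw).1).2.2.1
          exact h ⟨v, hv, hv'.trans (Finset.union_subset_union_right hwT)⟩
        rw [if_neg h, if_neg h', mul_one, mul_one]
        have := Finset.card_filter_add_card_filter_not (s := Ω) (fun w => l < 2 * (T W w).card)
        exact_mod_cast this.symm.le
    rw [pow_succ', show 1 - (1 - 64 * p) * (1 - 64 * p) ^ k =
      1 - (1 - 64 * p) * (1 - (1 - (1 - 64 * p) ^ k)) by ring, ← biasedSum_union,
      ← biasedSum_mul]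
    calc _ ≤ biasedSum u (64 * p) (fun W => N * ∑ R ∈ F W, p ^ R.card +
            N * ∑ j ∈ Finset.Icc 1 (l / 2), (1 / 4 : ℝ) ^ j) := by
          refine biasedSum_mono u (by positivity) hq fun W _ => ?_
          refine le_trans ?_ (add_le_add (hlost W) (hsmall W))
          have hb := biasedSum_const u (1 - (1 - 64 * p) ^ k) ((big W).card : ℝ)
          rw [← biasedSum_mul, ← biasedSum_mul, ← hb, ← biasedSum_add]
          exact biasedSum_mono u (by linarith) (by linarith) fun W' _ => hpt W W'
      _ ≤ N * (1 / 4) ^ l + N * ∑ j ∈ Finset.Icc 1 (l / 2), (1 / 4 : ℝ) ^ j := by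
          rw [biasedSum_add, biasedSum_mul, biasedSum_const]
          gcongr
      _ ≤ _ := by
          rw [← mul_add]
          refine mul_le_mul_of_nonneg_left ?_ hN
          -- Since l/2 ≤ l - 1, the new term (1/4)^l is not among those already spent.
          obtain ⟨m, rfl⟩ : ∃ m, l = m + 1 := ⟨l - 1, by omega⟩
          rw [Finset.sum_Icc_succ_top (by omega : 1 ≤ m + 1), add_comm]
          refine add_le_add_left (Finset.sum_le_sum_of_subset_of_nonneg
            (Finset.Icc_subset_Icc_right (by omega)) fun _ _ _ => by positivity) _

lemma sum_quarter_pow_le (l : ℕ) : ∑ j ∈ Finset.Icc 1 l, (1 / 4 : ℝ) ^ j ≤ 1 / 3 := by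
  have h : ∀ l : ℕ, ∑ j ∈ Finset.Icc 1 l, (1 / 4 : ℝ) ^ j = 1 / 3 * (1 - (1 / 4) ^ l) := by
    intro l
    induction l with
    | zero => simp
    | succ l ih => rw [Finset.sum_Icc_succ_top (by omega), ih, pow_succ]; ring
  rw [h]
  have : (0 : ℝ) < (1 / 4) ^ l := by positivity
  linarith

end Spread

/-! ### Expected copies and automorphisms -/

section Counting

lemma integral_eq_biasedSum (n : ℕ) (p : unitInterval) (f : SimpleGraph (Fin n) → ℝ) :
    ∫ G, f G ∂(binomialRandom (Fin n) p) =
      biasedSum (⊤ : SimpleGraph (Fin n)).edgeFinset (p : ℝ)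
        (fun S => f (fromEdgeSet (S : Set (Sym2 (Fin n))))) := by
  classical
  rw [integral_binomialRandom, biasedSum]
  refine Finset.sum_bij' (fun G _ => G.edgeFinset)
    (fun S _ => fromEdgeSet (S : Set (Sym2 (Fin n)))) ?_ ?_ ?_ ?_ ?_
  · intro G _
    exact Finset.mem_powerset.2 (edgeFinset_mono le_top)
  · simp
  · intro G _
    simp
  · intro S hS
    have hS' := Finset.mem_powerset.1 hS
    ext e
    simp only [mem_edgeFinset, edgeSet_fromEdgeSet, Set.mem_sdiff, Finset.mem_coe]
    refine ⟨fun h => h.1, fun h => ⟨h, ?_⟩⟩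
    have := hS' h
    simpa using this
  · intro G _
    have h1 : G.edgeSet.ncard = G.edgeFinset.card := by
      rw [← coe_edgeFinset, Set.ncard_coe_finset]
    rw [h1, card_edgeFinset_top_eq_card_choose_two]
    simp

variable {W U : Type*}

instance [Finite W] [Finite U] (J : SimpleGraph W) (G : SimpleGraph U) : Finite (Copy J G) :=
  DFunLike.finite _

instance [Finite W] [Finite U] (J : SimpleGraph W) (G : SimpleGraph U) : Finite (J ≃g G) :=
  DFunLike.finite _

lemma toSubgraph_coeCopy_comp {J : SimpleGraph W} {G : SimpleGraph U} (G' : G.Subgraph)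
    (e : J ≃g G'.coe) : (G'.coeCopy.comp e.toCopy).toSubgraph = G' := by
  have hc : ∀ a, (G'.coeCopy.comp e.toCopy) a = (e a : U) := fun a => rfl
  ext a b
  · simp only [Copy.toSubgraph, Subgraph.map_verts, Subgraph.verts_top, Set.image_univ,
      Set.mem_range, Copy.toHom_apply, hc]
    refine ⟨?_, fun ha => ⟨e.symm ⟨a, ha⟩, by simp⟩⟩
    rintro ⟨w, rfl⟩
    exact (e w).2
  · simp only [Copy.toSubgraph, Subgraph.map_adj, Relation.Map, Subgraph.top_adj,
      Copy.toHom_apply, hc]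
    constructor
    · rintro ⟨w, w', h, rfl, rfl⟩
      exact (e.map_rel_iff.2 h)
    · intro h
      refine ⟨e.symm ⟨a, h.fst_mem⟩, e.symm ⟨b, h.snd_mem⟩, ?_, by simp, by simp⟩
      rw [← e.map_rel_iff]
      simpa using h

/-- Fix an isomorphism from J onto each unlabelled copy. Precomposing it with automorphisms gives
distinct labelled copies, and the image of a labelled copy recovers the subgraph. -/
lemma copyCount_mul_card_aut_le [Fintype W] [Fintype U] (J : SimpleGraph W) (G : SimpleGraph U) :
    G.copyCount J * Nat.card (J ≃g J) ≤ Nat.card (Copy J G) := by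
  classical
  have h1 : G.copyCount J = Nat.card {G' : G.Subgraph // Nonempty (J ≃g G'.coe)} := by
    rw [copyCount, Nat.card_eq_fintype_card, Fintype.card_subtype]
  rw [h1, ← Nat.card_prod]
  refine Nat.card_le_card_of_injective
    (fun x : {G' : G.Subgraph // Nonempty (J ≃g G'.coe)} × (J ≃g J) =>
      x.1.1.coeCopy.comp (SimpleGraph.Iso.toCopy (x.2.trans x.1.2.some))) ?_
  rintro ⟨⟨G₁, h₁⟩, α⟩ ⟨⟨G₂, h₂⟩, β⟩ h
  have hG : G₁ = G₂ := by
    have := congrArg Copy.toSubgraph h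
    simpa only [toSubgraph_coeCopy_comp] using this
  subst hG
  have hαβ : α = β := by
    ext w
    have := DFunLike.congr_fun h w
    have h2 : ((h₁.some (α w) : G₁.verts) : U) = (h₁.some (β w) : G₁.verts) := this
    exact h₁.some.injective (Subtype.ext h2)
  rw [hαβ]

open Classical in
lemma natCard_copy_eq_sum [Fintype W] [Fintype U] (J : SimpleGraph W) (G : SimpleGraph U) :
    (Nat.card (Copy J G) : ℝ) = ∑ φ : W ↪ U, if J.map φ ≤ G then 1 else 0 := by
  rw [Finset.sum_boole, ← Fintype.card_subtype, ← Nat.card_eq_fintype_card]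
  refine congrArg _ (Nat.card_congr ⟨fun f => ⟨f.toEmbedding, ?_⟩,
    fun φ => ⟨⟨φ.1, ?_⟩, φ.1.injective⟩, fun f => rfl, fun φ => rfl⟩)
  · rw [map_le_iff_le_comap]
    exact fun a b h => f.toHom.map_adj h
  · intro a b h
    have h2 := φ.2
    rw [map_le_iff_le_comap] at h2
    exact h2 h

/-- Linearity of expectation over the at most n^{v_J} injections of the vertices, each present with
probability at most p^{e_J}. -/
lemma expCopies_mul_card_aut_le (n : ℕ) [Fintype W] (J : SimpleGraph W) (p : unitInterval) :
    expCopies n J p * Nat.card (J ≃g J) ≤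
      (n : ℝ) ^ Fintype.card W * (p : ℝ) ^ Nat.card J.edgeSet := by
  classical
  rw [expCopies, integral_eq_biasedSum, mul_comm, ← biasedSum_mul]
  set u := (⊤ : SimpleGraph (Fin n)).edgeFinset
  calc biasedSum u p (fun S => (Nat.card (J ≃g J) : ℝ) *
          ((fromEdgeSet (S : Set (Sym2 (Fin n)))).copyCount J : ℝ))
      ≤ biasedSum u p (fun S => ∑ φ : W ↪ Fin n, if (J.map φ).edgeFinset ⊆ S then 1 else 0) := by
        refine biasedSum_mono u p.2.1 p.2.2 fun S _ => ?_
        rw [mul_comm]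
        have h := copyCount_mul_card_aut_le J (fromEdgeSet (S : Set (Sym2 (Fin n))))
        have h2 := Nat.cast_le (α := ℝ).2 h
        rw [Nat.cast_mul, natCard_copy_eq_sum] at h2
        refine h2.trans (Finset.sum_le_sum fun φ _ => ?_)
        have himp : J.map φ ≤ fromEdgeSet (S : Set (Sym2 (Fin n))) →
            (J.map φ).edgeFinset ⊆ S := by
          intro h e he
          have := edgeSet_subset_edgeSet.2 h (mem_edgeFinset.1 he)
          simp only [edgeSet_fromEdgeSet, Set.mem_sdiff, Finset.mem_coe] at this
          exact this.1
        split_ifs with h1 h2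
        · exact le_rfl
        · exact absurd (himp h1) h2
        · exact zero_le_one
        · exact le_rfl
    _ = ∑ φ : W ↪ Fin n, biasedSum u p (fun S => if (J.map φ).edgeFinset ⊆ S then 1 else 0) := by
        simp only [biasedSum, Finset.mul_sum]
        rw [Finset.sum_comm]
    _ = ∑ φ : W ↪ Fin n, (p : ℝ) ^ Nat.card J.edgeSet := by
        refine Finset.sum_congr rfl fun φ _ => ?_
        rw [biasedSum_superset (edgeFinset_mono le_top), Nat.card_eq_fintype_card,
          ← edgeFinset_card, card_edgeFinset_map]
    _ ≤ _ := by
        rw [Finset.sum_const, nsmul_eq_mul, Finset.card_univ, Fintype.card_embedding_eq,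
          Fintype.card_fin]
        refine mul_le_mul_of_nonneg_right ?_ (pow_nonneg p.2.1 _)
        exact_mod_cast Nat.descFactorial_le_pow n _

lemma card_aut_congr {J : SimpleGraph W} {G : SimpleGraph U} (e : J ≃g G) :
    Nat.card (J ≃g J) = Nat.card (G ≃g G) :=
  Nat.card_congr ⟨fun α => (e.symm.trans α).trans e, fun α => (e.trans α).trans e.symm,
    fun α => by ext; simp, fun α => by ext; simp⟩

/-- If every subgraph of `H` has at least `1 / 2` expected copies, then the automorphism groups of
graphs contained in `H` are small. -/
lemma card_aut_le_of_isContained {n : ℕ} {V : Type*} [Finite V] {H : SimpleGraph V}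
    {p : unitInterval} (hp : ∀ I : H.Subgraph, 1 / 2 ≤ expCopies n I.coe p)
    [Fintype W] {J : SimpleGraph W} (hJ : J.IsContained H) :
    (Nat.card (J ≃g J) : ℝ) ≤ 2 * ((n : ℝ) ^ Fintype.card W * (p : ℝ) ^ Nat.card J.edgeSet) := by
  classical
  cases nonempty_fintype V
  obtain ⟨f⟩ := hJ
  let e := f.isoToSubgraph
  have h1 := expCopies_mul_card_aut_le n f.toSubgraph.coe p
  have h2 := hp f.toSubgraph
  have h3 : Nat.card (J ≃g J) = Nat.card (f.toSubgraph.coe ≃g f.toSubgraph.coe) :=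
    card_aut_congr e
  have h4 : Fintype.card W = Fintype.card f.toSubgraph.verts := Fintype.card_congr e.toEquiv
  have h5 : Nat.card J.edgeSet = Nat.card f.toSubgraph.coe.edgeSet :=
    Nat.card_congr e.mapEdgeSet
  rw [h3, h4, h5]
  have h6 : (0 : ℝ) ≤ Nat.card (f.toSubgraph.coe ≃g f.toSubgraph.coe) := Nat.cast_nonneg _
  nlinarith

end Counting

/-! ### Acyclicity of H and multiplicities of its components -/

section Structure

variable {n : ℕ} {V : Type*} {H : SimpleGraph V} {p : unitInterval}

/-- A k-cycle has at least the identity automorphism, whereas the automorphism bound would give at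
most 2x^k ≤ 2/27. -/
lemma isAcyclic_of_expCopies [Finite V] (hp : ∀ I : H.Subgraph, 1 / 2 ≤ expCopies n I.coe p)
    (hx : (n : ℝ) * p ≤ 1 / 3) : H.IsAcyclic := by
  classical
  rw [isAcyclic_iff_free_cycleGraph]
  intro k hk hcont
  have h := card_aut_le_of_isContained hp hcont
  obtain ⟨m, rfl⟩ : ∃ m, k = m + 3 := ⟨k - 3, by omega⟩
  have he : Nat.card (cycleGraph (m + 3)).edgeSet = m + 3 := by
    have h1 := sum_degrees_eq_twice_card_edges (cycleGraph (m + 3))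
    simp only [cycleGraph_degree_three_le, Finset.sum_const, Finset.card_univ, Fintype.card_fin,
      smul_eq_mul] at h1
    rw [Nat.card_eq_fintype_card, ← edgeFinset_card]
    omega
  rw [he, Fintype.card_fin, ← mul_pow] at h
  have h0 : 0 ≤ (n : ℝ) * p := mul_nonneg (Nat.cast_nonneg n) p.2.1
  have h1 : (1 : ℝ) ≤ Nat.card (cycleGraph (m + 3) ≃g cycleGraph (m + 3)) := by
    have : Nonempty (cycleGraph (m + 3) ≃g cycleGraph (m + 3)) := ⟨.refl⟩
    exact_mod_cast Nat.card_pos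
  have h2 : ((n : ℝ) * p) ^ (m + 3) ≤ (1 / 3) ^ 3 :=
    (pow_le_pow_left₀ h0 hx _).trans
      (pow_le_pow_of_le_one (by norm_num) (by norm_num) (by omega))
  norm_num at h2
  linarith

/-- Permuting disjoint copies of a graph, and applying an automorphism to each. -/
def boxProdBotAut {ι W : Type*} (G : SimpleGraph W) (σ : Equiv.Perm ι) (α : ι → (G ≃g G)) :
    ((⊥ : SimpleGraph ι) □ G) ≃g ((⊥ : SimpleGraph ι) □ G) where
  toFun x := (σ x.1, α x.1 x.2)
  invFun x := (σ.symm x.1, (α (σ.symm x.1)).symm x.2)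
  left_inv x := by simp
  right_inv x := by simp
  map_rel_iff' := by
    rintro ⟨i, a⟩ ⟨j, b⟩
    simp only [Equiv.coe_fn_mk, boxProd_adj, bot_adj, false_and, false_or,
      EmbeddingLike.apply_eq_iff_eq]
    constructor
    · rintro ⟨h, rfl⟩
      exact ⟨(α i).map_rel_iff.1 h, rfl⟩
    · rintro ⟨h, rfl⟩
      exact ⟨(α i).map_rel_iff.2 h, rfl⟩

/-- The box product with an edgeless graph on `ι` is a disjoint union of copies of `G`. A vertex of
`G` is needed to read off the permutation of the copies. -/
lemma factorial_mul_card_aut_pow_le {ι W : Type*} [Fintype ι] [Finite W] [Nonempty W]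
    (G : SimpleGraph W) :
    (Fintype.card ι).factorial * Nat.card (G ≃g G) ^ Fintype.card ι ≤
      Nat.card (((⊥ : SimpleGraph ι) □ G) ≃g ((⊥ : SimpleGraph ι) □ G)) := by
  classical
  have h : Nat.card (Equiv.Perm ι × (ι → (G ≃g G))) =
      (Fintype.card ι).factorial * Nat.card (G ≃g G) ^ Fintype.card ι := by
    rw [Nat.card_prod, Nat.card_eq_fintype_card, Fintype.card_perm, Nat.card_fun,
      Nat.card_eq_fintype_card (α := ι)]
  rw [← h]
  refine Nat.card_le_card_of_injective (fun x => boxProdBotAut G x.1 x.2) ?_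
  rintro ⟨σ, α⟩ ⟨τ, β⟩ hxy
  have hpt : ∀ i a, (σ i, α i a) = (τ i, β i a) := fun i a => DFunLike.congr_fun hxy (i, a)
  obtain ⟨w⟩ := ‹Nonempty W›
  have h1 : σ = τ := Equiv.ext fun i => (Prod.ext_iff.1 (hpt i w)).1
  have h2 : α = β := funext fun i => RelIso.ext fun a => (Prod.ext_iff.1 (hpt i a)).2
  rw [h1, h2]

lemma card_mul_card_edgeSet_le {ι W : Type*} [Finite ι] [Finite W] (G : SimpleGraph W) :
    Nat.card ι * Nat.card G.edgeSet ≤ Nat.card ((⊥ : SimpleGraph ι) □ G).edgeSet := by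
  rw [← Nat.card_prod]
  let f : ι → G →g ((⊥ : SimpleGraph ι) □ G) := fun i => ⟨fun a => (i, a), fun h => by simp [h]⟩
  refine Nat.card_le_card_of_injective (fun x => (f x.1).mapEdgeSet x.2) ?_
  rintro ⟨i, e, he⟩ ⟨j, e', he'⟩ h
  have h2 : Sym2.map (f i) e = Sym2.map (f j) e' := congrArg Subtype.val h
  induction e with | _ a b
  induction e' with | _ c d
  simp only [Sym2.map_mk, f, RelHom.coeFn_mk, Sym2.eq_iff, Prod.mk.injEq] at h2
  have h3 : i = j := by tauto
  subst h3
  have h4 : s(a, b) = s(c, d) := by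
    rw [Sym2.eq_iff]
    tauto
  simp only [h4]

/-- The components of `H` which are isomorphic to a given component. -/
def isoClass (H : SimpleGraph V) (D : H.ConnectedComponent) : Set H.ConnectedComponent :=
  {D' | Nonempty (D.toSimpleGraph ≃g D'.toSimpleGraph)}

lemma mem_isoClass_self (D : H.ConnectedComponent) : D ∈ isoClass H D := ⟨.refl⟩

/-- Chosen isomorphisms from D onto the members of its class have images in distinct components, so
together they are injective. -/
lemma isoClass_boxProd_isContained (D : H.ConnectedComponent) :
    ((⊥ : SimpleGraph (isoClass H D)) □ D.toSimpleGraph).IsContained H := by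
  let e : ∀ D' : isoClass H D, D.toSimpleGraph ≃g D'.1.toSimpleGraph := fun D' => D'.2.some
  have hsupp : ∀ x : isoClass H D × D, H.connectedComponentMk (e x.1 x.2 : V) = x.1.1 := fun x =>
    (e x.1 x.2).2
  refine ⟨⟨⟨fun x => (e x.1 x.2 : V), ?_⟩, ?_⟩⟩
  · rintro ⟨i, a⟩ ⟨j, b⟩ h
    simp only [boxProd_adj, bot_adj, false_and, false_or] at h
    obtain ⟨h, rfl⟩ := h
    exact (e i).map_rel_iff.2 h
  · rintro ⟨i, a⟩ ⟨j, b⟩ h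
    have h0 : (e i a : V) = (e j b : V) := h
    have hij : i = j := Subtype.ext (by
      have h1 := hsupp (i, a)
      have h2 := hsupp (j, b)
      simp only at h1 h2
      rw [← h1, ← h2, h0])
    subst hij
    rw [(e i).injective (Subtype.ext h0)]

/-- A component with many automorphisms cannot appear many times. -/
lemma card_isoClass_mul_card_aut_le [Finite V] (hp : ∀ I : H.Subgraph, 1 / 2 ≤ expCopies n I.coe p)
    (D : H.ConnectedComponent) :
    (Nat.card (isoClass H D) : ℝ) * Nat.card (D.toSimpleGraph ≃g D.toSimpleGraph) ≤
      6 * n * ((n : ℝ) * p) ^ (Nat.card D - 1) := by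
  classical
  cases nonempty_fintype V
  have : Fintype (isoClass H D) := Fintype.ofFinite _
  have : Nonempty D := D.connected_toSimpleGraph.nonempty
  set m := Nat.card (isoClass H D) with hm
  have hm1 : 1 ≤ m := by
    have : Nonempty (isoClass H D) := ⟨⟨D, mem_isoClass_self D⟩⟩
    exact Nat.card_pos
  set a := Nat.card (D.toSimpleGraph ≃g D.toSimpleGraph) with ha
  set s := Nat.card D with hs
  have hs1 : 1 ≤ s := Nat.card_pos
  have hn : (0 : ℝ) ≤ n := Nat.cast_nonneg n
  have hp0 : (0 : ℝ) ≤ p := p.2.1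
  have h1 := card_aut_le_of_isContained hp (isoClass_boxProd_isContained D)
  have h2 := factorial_mul_card_aut_pow_le (ι := isoClass H D) D.toSimpleGraph
  have h3 := card_mul_card_edgeSet_le (ι := isoClass H D) D.toSimpleGraph
  have h4 := D.connected_toSimpleGraph.card_vert_le_card_edgeSet_add_one
  rw [Fintype.card_prod, ← Nat.card_eq_fintype_card, ← Nat.card_eq_fintype_card, ← hm, ← hs] at h1
  rw [← Nat.card_eq_fintype_card, ← hm, ← ha] at h2
  set X := (n : ℝ) * ((n : ℝ) * p) ^ (s - 1) with hX
  have hX0 : 0 ≤ X := by positivity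
  -- Connectedness gives at least m(s - 1) edges, and a lower bound is what is needed because p ≤ 1.
  have h5 : (n : ℝ) ^ (m * s) * (p : ℝ) ^
      Nat.card ((⊥ : SimpleGraph (isoClass H D)) □ D.toSimpleGraph).edgeSet ≤ X ^ m := by
    have h6 : X ^ m = (n : ℝ) ^ (m * s) * (p : ℝ) ^ (m * (s - 1)) := by
      obtain ⟨r, hr⟩ : ∃ r, s = r + 1 := ⟨s - 1, by omega⟩
      rw [hX, hr, Nat.add_sub_cancel, mul_pow, mul_pow, mul_pow, ← pow_mul, ← pow_mul]
      ring
    rw [h6]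
    refine mul_le_mul_of_nonneg_left ?_ (by positivity)
    refine pow_le_pow_of_le_one hp0 p.2.2 (le_trans ?_ h3)
    exact Nat.mul_le_mul_left _ (by omega)
  have h7 : ((m.factorial : ℝ)) * (a : ℝ) ^ m ≤ 2 * X ^ m := by
    have : ((m.factorial * a ^ m : ℕ) : ℝ) ≤ _ := (Nat.cast_le.2 h2).trans h1
    push_cast at this
    linarith
  -- From m^m ≤ e^m m! with e < 3, and 2 ≤ 2^m; hence the constant 6 = 3 · 2 after an m-th root.
  have h8 : ((m : ℝ) * a) ^ m ≤ (6 * X) ^ m := by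
    have h9 := Real.pow_div_factorial_le_exp (x := (m : ℝ)) (Nat.cast_nonneg m) m
    have hf : (0 : ℝ) < m.factorial := by exact_mod_cast m.factorial_pos
    rw [div_le_iff₀ hf] at h9
    have he : Real.exp m ≤ 3 ^ m := by
      rw [← mul_one (m : ℝ), Real.exp_nat_mul]
      exact pow_le_pow_left₀ (Real.exp_pos _).le (by linarith [Real.exp_one_lt_d9]) _
    have h2m : (2 : ℝ) ≤ 2 ^ m := by
      simpa using pow_le_pow_right₀ (by norm_num : (1 : ℝ) ≤ 2) hm1
    calc ((m : ℝ) * a) ^ m = (m : ℝ) ^ m * a ^ m := mul_pow _ _ _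
      _ ≤ Real.exp m * m.factorial * a ^ m := by gcongr
      _ = Real.exp m * (m.factorial * a ^ m) := by ring
      _ ≤ 3 ^ m * (2 ^ m * X ^ m) := by
          refine mul_le_mul he (h7.trans ?_) (by positivity) (by positivity)
          exact mul_le_mul_of_nonneg_right h2m (by positivity)
      _ = (6 * X) ^ m := by rw [← mul_pow, ← mul_pow]; ring_nf
  have := le_of_pow_le_pow_left₀ (by omega) (by positivity) h8
  rw [hX] at this
  linarith

end Structure

/-! ### Counting trees that extend a given connected graph -/

section TreeExtensions

variable {τ : Type*}

/-- The trees on `τ ⊕ Fin r` which contain the graph `T` on `τ`. -/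
def treeExtensions (T : SimpleGraph τ) (r : ℕ) : Set (SimpleGraph (τ ⊕ Fin r)) :=
  {G | G.IsTree ∧ ∀ a b, T.Adj a b → G.Adj (Sum.inl a) (Sum.inl b)}

/-- The graph on `τ ⊕ Fin r` obtained from `T` by joining every new vertex to its parent. -/
def parentGraph (T : SimpleGraph τ) {r : ℕ} (f : Fin r → τ ⊕ Fin r) :
    SimpleGraph (τ ⊕ Fin r) :=
  SimpleGraph.fromRel fun x y =>
    (∃ a b, T.Adj a b ∧ x = Sum.inl a ∧ y = Sum.inl b) ∨ ∃ i, x = Sum.inr i ∧ y = f i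

lemma exists_adj_dist_lt {U : Type*} {G : SimpleGraph U} (hG : G.Connected) {u v : U}
    (h : u ≠ v) : ∃ w, G.Adj u w ∧ G.dist w v < G.dist u v := by
  obtain ⟨W, hW⟩ := hG.exists_walk_length_eq_dist u v
  cases W with
  | nil => exact absurd rfl h
  | cons hadj W' =>
    refine ⟨_, hadj, ?_⟩
    rw [← hW, Walk.length_cons]
    exact Nat.lt_succ_of_le (dist_le W')

/-- Root the tree at a vertex of T and let each new vertex choose a neighbour closer to the root.
These edges and T already form a connected graph, which is the whole tree because a tree is
minimally connected. So the parent function determines the tree. -/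
lemma ncard_treeExtensions_le [Finite τ] {T : SimpleGraph τ} (hT : T.Connected) (r : ℕ) :
    (treeExtensions T r).ncard ≤ (Nat.card τ + r) ^ r := by
  classical
  obtain ⟨a₀⟩ := hT.nonempty
  have hpar : ∀ G : treeExtensions T r, ∃ f : Fin r → τ ⊕ Fin r, ∀ i,
      G.1.Adj (Sum.inr i) (f i) ∧ G.1.dist (f i) (Sum.inl a₀) < G.1.dist (Sum.inr i) (Sum.inl a₀) :=
    fun G => by
      choose f hf using fun i : Fin r =>
        exists_adj_dist_lt G.2.1.connected (u := Sum.inr i) (v := Sum.inl a₀) (by simp)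
      exact ⟨f, hf⟩
  choose f hf using hpar
  have hle : ∀ G : treeExtensions T r, parentGraph T (f G) ≤ G.1 := by
    intro G x y hxy
    have hrel : ∀ x y, ((∃ a b, T.Adj a b ∧ x = Sum.inl a ∧ y = Sum.inl b) ∨
        ∃ i, x = Sum.inr i ∧ y = f G i) → G.1.Adj x y := by
      rintro x y (⟨a, b, hab, rfl, rfl⟩ | ⟨i, rfl, rfl⟩)
      · exact G.2.2 a b hab
      · exact (hf G i).1
    rw [parentGraph, fromRel_adj] at hxy
    exact hxy.2.elim (hrel x y) fun h => (hrel y x h).symm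
  have hconn : ∀ G : treeExtensions T r, (parentGraph T (f G)).Connected := by
    intro G
    have hreach : ∀ (k : ℕ) (x : τ ⊕ Fin r), G.1.dist x (Sum.inl a₀) < k →
        (parentGraph T (f G)).Reachable x (Sum.inl a₀) := by
      intro k
      induction k with
      | zero => intro x hx; omega
      | succ k ih =>
        rintro (a | i) hx
        · let F : T →g parentGraph T (f G) := ⟨Sum.inl, fun {a b} hab => by
            rw [parentGraph, fromRel_adj]
            exact ⟨fun h => hab.ne (Sum.inl_injective h), Or.inl (Or.inl ⟨a, b, hab, rfl, rfl⟩)⟩⟩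
          exact (hT.preconnected a a₀).map F
        · have hadj : (parentGraph T (f G)).Adj (Sum.inr i) (f G i) := by
            rw [parentGraph, fromRel_adj]
            exact ⟨(hf G i).1.ne, Or.inl (Or.inr ⟨i, rfl, rfl⟩)⟩
          exact hadj.reachable.trans (ih _ (by have := (hf G i).2; omega))
    have : Nonempty (τ ⊕ Fin r) := ⟨Sum.inl a₀⟩
    exact ⟨fun x y => (hreach _ x (Nat.lt_succ_self _)).trans
      (hreach _ y (Nat.lt_succ_self _)).symm⟩
  have heq : ∀ G : treeExtensions T r, parentGraph T (f G) = G.1 := fun G =>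
    (hle G).antisymm ((isTree_iff_minimal_connected.1 G.2.1).2 (hconn G) (hle G))
  have hinj : Function.Injective f := fun G G' h => Subtype.ext (by
    rw [← heq G, ← heq G', h])
  have h := Nat.card_le_card_of_injective f hinj
  rw [Nat.card_coe_set_eq, Nat.card_fun, Nat.card_sum, Nat.card_fin] at h
  exact h

end TreeExtensions

/-! ### Copies of a tree in H -/

section TreeCopies

variable {V τ : Type*} {H : SimpleGraph V} {T : SimpleGraph τ}

lemma isoClass_congr {D D' : H.ConnectedComponent}
    (e : D.toSimpleGraph ≃g D'.toSimpleGraph) : isoClass H D = isoClass H D' := by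
  ext E
  exact ⟨fun ⟨g⟩ => ⟨e.symm.trans g⟩, fun ⟨g⟩ => ⟨e.trans g⟩⟩

variable [Finite V] [Finite τ]

/-- The bijections from `τ ⊕ Fin r` to the vertex set of `G` which extend a copy of `T`. -/
def copyExtensions {W : Type*} (T : SimpleGraph τ) (r : ℕ) (G : SimpleGraph W) : Type _ :=
  {β : τ ⊕ Fin r ≃ W // ∀ a b, T.Adj a b → G.Adj (β (Sum.inl a)) (β (Sum.inl b))}

instance {W : Type*} [Finite W] (r : ℕ) (G : SimpleGraph W) : Finite (copyExtensions T r G) :=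
  inferInstanceAs (Finite {β : τ ⊕ Fin r ≃ W //
    ∀ a b, T.Adj a b → G.Adj (β (Sum.inl a)) (β (Sum.inl b))})

/-- A copy of T leaves out r vertices, which can be labelled in r! ways. -/
lemma card_copy_mul_factorial_le {W : Type*} [Finite W] (G : SimpleGraph W) {r : ℕ}
    (hW : Nat.card W = Nat.card τ + r) :
    Nat.card (Copy T G) * r.factorial ≤ Nat.card (copyExtensions T r G) := by
  classical
  cases nonempty_fintype W
  cases nonempty_fintype τ
  have hr : r.factorial = Nat.card (Equiv.Perm (Fin r)) := by
    rw [Nat.card_eq_fintype_card, Fintype.card_perm, Fintype.card_fin]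
  have hcompl : ∀ f : Copy T G, Nonempty (Fin r ≃ {w // w ∉ Set.range f}) := fun f => by
    refine ⟨Fintype.equivOfCardEq ?_⟩
    have h1 := Fintype.card_subtype_compl (fun w => w ∈ Set.range f)
    have h2 : Fintype.card {w // w ∈ Set.range f} = Fintype.card τ :=
      (Fintype.card_congr (Equiv.ofInjective f f.injective)).symm
    rw [Nat.card_eq_fintype_card, Nat.card_eq_fintype_card] at hW
    rw [h1, h2, hW, Fintype.card_fin]
    omega
  have g : ∀ f : Copy T G, Fin r ≃ {w // w ∉ Set.range f} := fun f => (hcompl f).some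
  rw [hr, ← Nat.card_prod]
  have hbij : ∀ (f : Copy T G) (π : Equiv.Perm (Fin r)),
      Function.Bijective (Sum.elim f (fun i => (g f (π i) : W))) := by
    intro f π
    rw [Fintype.bijective_iff_injective_and_card]
    refine ⟨?_, by
      rw [← Nat.card_eq_fintype_card, ← Nat.card_eq_fintype_card, hW, Nat.card_sum, Nat.card_fin]⟩
    refine f.injective.sumElim ?_ ?_
    · intro i j h
      exact π.injective ((g f).injective (Subtype.ext h))
    · intro a i h
      exact (g f (π i)).2 ⟨a, h⟩
  refine Nat.card_le_card_of_injective (fun x : Copy T G × Equiv.Perm (Fin r) =>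
    (⟨Equiv.ofBijective _ (hbij x.1 x.2), fun a b h => x.1.toHom.map_adj h⟩ :
      copyExtensions T r G)) ?_
  rintro ⟨f, π⟩ ⟨f', π'⟩ h
  have hpt : ∀ y, Sum.elim f (fun i => (g f (π i) : W)) y =
      Sum.elim f' (fun i => (g f' (π' i) : W)) y := fun y =>
    DFunLike.congr_fun (congrArg Subtype.val h) y
  have h1 : f = f' := Copy.ext fun a => hpt (Sum.inl a)
  subst h1
  have h2 : π = π' := Equiv.ext fun i => (g f).injective (Subtype.ext (hpt (Sum.inr i)))
  rw [h2]

lemma one_le_card_isoClass_mul_card_aut (D : H.ConnectedComponent) :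
    (1 : ℝ) ≤ (Nat.card (isoClass H D) : ℝ) * Nat.card (D.toSimpleGraph ≃g D.toSimpleGraph) := by
  have h1 : Nonempty (isoClass H D) := ⟨⟨D, mem_isoClass_self D⟩⟩
  have h2 : Nonempty (D.toSimpleGraph ≃g D.toSimpleGraph) := ⟨.refl⟩
  exact_mod_cast Nat.mul_pos (Nat.card_pos (α := isoClass H D))
    (Nat.card_pos (α := D.toSimpleGraph ≃g D.toSimpleGraph))

open Classical in
/-- The components of `H` of a given order, weighted so that every isomorphism class is counted
once, contain few copies of `T`. -/
lemma sum_card_copy_div_le [Fintype H.ConnectedComponent] (hH : H.IsAcyclic) (hT : T.Connected)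
    (r : ℕ) :
    ∑ D ∈ Finset.univ.filter (fun D : H.ConnectedComponent => Nat.card D = Nat.card τ + r),
      (Nat.card (Copy T D.toSimpleGraph) : ℝ) / ((Nat.card (isoClass H D) : ℝ) *
        Nat.card (D.toSimpleGraph ≃g D.toSimpleGraph)) ≤
      ((Nat.card τ + r : ℕ) : ℝ) ^ r / r.factorial := by
  let w : H.ConnectedComponent → ℝ := fun D =>
    ((Nat.card (isoClass H D) : ℝ) * Nat.card (D.toSimpleGraph ≃g D.toSimpleGraph))⁻¹
  have hw : ∀ D, 0 ≤ w D := fun D => by positivity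
  have : ∀ D : H.ConnectedComponent, Fintype (copyExtensions T r D.toSimpleGraph) :=
    fun D => Fintype.ofFinite _
  let g : (Σ D : H.ConnectedComponent, copyExtensions T r D.toSimpleGraph) → SimpleGraph (τ ⊕ Fin r) := fun x => x.1.toSimpleGraph.comap x.2.1
  let iso : ∀ x : Σ D : H.ConnectedComponent, copyExtensions T r D.toSimpleGraph, g x ≃g x.1.toSimpleGraph := fun x => ⟨x.2.1, Iff.rfl⟩
  have : Fintype (treeExtensions T r) := Fintype.ofFinite _
  have hg : ∀ x, g x ∈ (treeExtensions T r).toFinset := fun x => by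
    rw [Set.mem_toFinset]
    exact ⟨(iso x).isTree_iff.2 (hH.isTree_connectedComponent x.1), x.2.2⟩
  -- All pairs (D, β) pulling back to the same G have D in one isomorphism class, and for given D
  -- the bijection β is determined by an automorphism. So there are at most m|Aut D| pairs, each of
  -- weight 1/(m|Aut D|).
  have hfib : ∀ G : SimpleGraph (τ ⊕ Fin r), ∑ x with g x = G, w x.1 ≤ 1 := by
    intro G
    rcases (Finset.univ.filter fun x => g x = G).eq_empty_or_nonempty with he | ⟨x₀, hx₀⟩
    · rw [he, Finset.sum_empty]; exact zero_le_one
    have hx₀' : g x₀ = G := (Finset.mem_filter.1 hx₀).2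
    subst hx₀'
    let e : ∀ x : {x // g x = g x₀}, x₀.1.toSimpleGraph ≃g x.1.1.toSimpleGraph := fun x =>
      (iso x₀).symm.trans ((SimpleGraph.Iso.refl.trans ⟨Equiv.refl _, by rw [x.2]; rfl⟩ :
        g x₀ ≃g g x.1).trans (iso x.1))
    have hwx : ∀ x ∈ Finset.univ.filter (fun x => g x = g x₀), w x.1 = w x₀.1 := by
      intro x hx
      have ex := e ⟨x, (Finset.mem_filter.1 hx).2⟩
      simp only [w]
      rw [isoClass_congr ex, card_aut_congr ex]
    rw [Finset.sum_congr rfl hwx, Finset.sum_const, nsmul_eq_mul]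
    have hpos := one_le_card_isoClass_mul_card_aut x₀.1
    simp only [w]
    rw [← div_eq_mul_inv, div_le_one (by linarith)]
    have hcard : Nat.card {x // g x = g x₀} ≤
        Nat.card (isoClass H x₀.1 × (x₀.1.toSimpleGraph ≃g x₀.1.toSimpleGraph)) := by
      let c : ∀ D : isoClass H x₀.1, x₀.1.toSimpleGraph ≃g D.1.toSimpleGraph := fun D => D.2.some
      refine Nat.card_le_card_of_injective (fun x => (⟨x.1.1, ⟨e x⟩⟩,
        (e x).trans (c ⟨x.1.1, ⟨e x⟩⟩).symm)) ?_
      rintro ⟨⟨D, β, hβ⟩, hx⟩ ⟨⟨D', β', hβ'⟩, hx'⟩ h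
      rw [Prod.mk.injEq] at h
      obtain ⟨h1, h2⟩ := h
      have h3 : D = D' := congrArg Subtype.val h1
      subst h3
      have h4 : β = β' := by
        ext y : 1
        have h5 := DFunLike.congr_fun h2 (x₀.2.1 y)
        have h6 := (c ⟨D, ⟨e ⟨⟨D, β, hβ⟩, hx⟩⟩⟩).symm.injective h5
        have h7 : β ((iso x₀).symm (x₀.2.1 y)) = β' ((iso x₀).symm (x₀.2.1 y)) := h6
        have h8 : (iso x₀).symm (x₀.2.1 y) = y := (iso x₀).toEquiv.symm_apply_apply y
        rwa [h8] at h7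
      subst h4
      rfl
    rw [Nat.card_prod, Nat.card_eq_fintype_card, Fintype.card_subtype] at hcard
    exact_mod_cast hcard
  have hr : (0 : ℝ) < r.factorial := by exact_mod_cast r.factorial_pos
  rw [le_div_iff₀ hr, Finset.sum_mul]
  calc _ ≤ ∑ D : H.ConnectedComponent, (Nat.card (copyExtensions T r D.toSimpleGraph) : ℝ) * w D := by
        rw [← Finset.sum_filter_add_sum_filter_not Finset.univ
          (fun D : H.ConnectedComponent => Nat.card D = Nat.card τ + r)
          (fun D => (Nat.card (copyExtensions T r D.toSimpleGraph) : ℝ) * w D)]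
        refine le_add_of_le_of_nonneg (Finset.sum_le_sum fun D hD => ?_)
          (Finset.sum_nonneg fun D _ => mul_nonneg (Nat.cast_nonneg _) (hw D))
        have h := card_copy_mul_factorial_le (T := T) D.toSimpleGraph (Finset.mem_filter.1 hD).2
        rw [div_mul_eq_mul_div, div_eq_mul_inv]
        exact mul_le_mul_of_nonneg_right (by exact_mod_cast h) (hw D)
    _ = ∑ x : (Σ D : H.ConnectedComponent, copyExtensions T r D.toSimpleGraph), w x.1 := by
        rw [Fintype.sum_sigma]
        refine Finset.sum_congr rfl fun D _ => ?_
        simp only [Finset.sum_const, Finset.card_univ, nsmul_eq_mul, Nat.card_eq_fintype_card]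
    _ = ∑ G ∈ (treeExtensions T r).toFinset, ∑ x with g x = G, w x.1 :=
        (Finset.sum_fiberwise_of_maps_to (fun x _ => hg x) _).symm
    _ ≤ ∑ G ∈ (treeExtensions T r).toFinset, 1 := Finset.sum_le_sum fun G _ => hfib G
    _ ≤ ((Nat.card τ + r : ℕ) : ℝ) ^ r := by
        rw [Finset.sum_const, nsmul_eq_mul, mul_one, ← Set.ncard_eq_toFinset_card']
        exact_mod_cast ncard_treeExtensions_le hT r

lemma card_copy_le_sum [Fintype H.ConnectedComponent] (hT : T.Connected) :
    Nat.card (Copy T H) ≤ ∑ D : H.ConnectedComponent, Nat.card (Copy T D.toSimpleGraph) := by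
  obtain ⟨a₀⟩ := hT.nonempty
  rw [← Nat.card_sigma]
  have hmem : ∀ (f : Copy T H) (a : τ), f a ∈ H.connectedComponentMk (f a₀) := fun f a =>
    ConnectedComponent.sound ((hT.preconnected a a₀).map f.toHom)
  refine Nat.card_le_card_of_injective (fun f => ⟨H.connectedComponentMk (f a₀),
    ⟨⟨fun a => ⟨f a, hmem f a⟩, fun h => f.toHom.map_adj h⟩,
      fun a b h => f.injective (congrArg Subtype.val h)⟩⟩) ?_
  intro f f' h
  have h1 : ∀ (x y : Σ D : H.ConnectedComponent, Copy T D.toSimpleGraph), x = y →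
      ∀ a, ((x.2 a : x.1) : V) = (y.2 a : y.1) := by rintro x _ rfl a; rfl
  exact Copy.ext fun a => h1 _ _ h a

/-- The bound on m|Aut D| decays like x^{t+r-1} in the order t+r of the component, which beats the
growth e^{t+r} of the weighted count of copies. -/
lemma card_copy_le_pow {n : ℕ} {p : unitInterval} (hn : Nat.card V ≤ n)
    (hp : ∀ I : H.Subgraph, 1 / 2 ≤ expCopies n I.coe p) (hx : (n : ℝ) * p ≤ 1 / 3)
    (hT : T.Connected) :
    (Nat.card (Copy T H) : ℝ) ≤ n * (600 * ((n : ℝ) * p)) ^ (Nat.card τ - 1) := by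
  classical
  have : Fintype H.ConnectedComponent := Fintype.ofFinite _
  have : Nonempty τ := hT.nonempty
  have hH := isAcyclic_of_expCopies hp hx
  set t := Nat.card τ with ht
  have ht1 : 1 ≤ t := Nat.card_pos
  set x := (n : ℝ) * p with hxdef
  have hx0 : 0 ≤ x := mul_nonneg (Nat.cast_nonneg n) p.2.1
  have hn0 : (0 : ℝ) ≤ n := Nat.cast_nonneg n
  -- For a single vertex the exponent is 0 and can absorb no constant, so this case is counted
  -- directly.
  rcases ht1.eq_or_lt with h1 | ht2
  · rw [← h1, Nat.sub_self, pow_zero, mul_one]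
    have h2 : Nat.card (Copy T H) ≤ Nat.card (τ → V) :=
      Nat.card_le_card_of_injective (fun f => (f : τ → V)) DFunLike.coe_injective
    rw [Nat.card_fun, ← ht, ← h1, pow_one] at h2
    exact_mod_cast h2.trans hn
  set c : H.ConnectedComponent → ℝ := fun D => (Nat.card (Copy T D.toSimpleGraph) : ℝ) with hc
  set M : H.ConnectedComponent → ℝ := fun D => (Nat.card (isoClass H D) : ℝ) *
    Nat.card (D.toSimpleGraph ≃g D.toSimpleGraph) with hM
  have hM1 : ∀ D, 1 ≤ M D := one_le_card_isoClass_mul_card_aut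
  have hsize : ∀ D, c D ≠ 0 → ∃ r < Nat.card V + 1, Nat.card D = t + r := by
    intro D hD
    have : Nonempty (Copy T D.toSimpleGraph) := by
      by_contra h
      rw [not_nonempty_iff] at h
      exact hD (by simp [hc])
    obtain ⟨f⟩ := this
    have h1 : t ≤ Nat.card D := Nat.card_le_card_of_injective f f.injective
    have h2 : Nat.card D ≤ Nat.card V :=
      Nat.card_le_card_of_injective _ Subtype.val_injective
    exact ⟨Nat.card D - t, by omega, by omega⟩
  -- Here e/3 < 10/11, so the geometric series is at most 11.
  have he3 : Real.exp 1 * x ≤ 10 / 11 := by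
    have := Real.exp_one_lt_d9
    nlinarith
  have hex0 : 0 ≤ Real.exp 1 * x := by positivity
  have hgeom : ∑ r ∈ Finset.range (Nat.card V + 1), (Real.exp 1 * x) ^ r ≤ 11 := by
    have h1 := mul_neg_geom_sum (Real.exp 1 * x) (Nat.card V + 1)
    have h2 : 0 ≤ (Real.exp 1 * x) ^ (Nat.card V + 1) := by positivity
    have h3 : 0 ≤ ∑ r ∈ Finset.range (Nat.card V + 1), (Real.exp 1 * x) ^ r :=
      Finset.sum_nonneg fun _ _ => by positivity
    nlinarith
  calc (Nat.card (Copy T H) : ℝ) ≤ ∑ D : H.ConnectedComponent, c D := by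
        simp only [hc]
        have h := card_copy_le_sum (H := H) hT
        exact_mod_cast h
    _ ≤ ∑ D : H.ConnectedComponent, ∑ r ∈ Finset.range (Nat.card V + 1), if Nat.card D = t + r then c D else 0 := by
        refine Finset.sum_le_sum fun D _ => ?_
        by_cases hD : c D = 0
        · simp [hD]
        · obtain ⟨r, hr, hDr⟩ := hsize D hD
          have := Finset.single_le_sum (f := fun r => if Nat.card D = t + r then c D else 0)
            (fun r _ => by split_ifs <;> simp [hc]) (Finset.mem_range.2 hr)
          simpa [hDr] using this
    _ = ∑ r ∈ Finset.range (Nat.card V + 1),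
          ∑ D ∈ Finset.univ.filter (fun D : H.ConnectedComponent => Nat.card D = t + r), c D := by
        rw [Finset.sum_comm]
        simp only [Finset.sum_filter]
    _ ≤ ∑ r ∈ Finset.range (Nat.card V + 1),
          (6 * n * x ^ (t - 1) * Real.exp 1 ^ t) * (Real.exp 1 * x) ^ r := by
        refine Finset.sum_le_sum fun r _ => ?_
        have h1 : ∑ D ∈ Finset.univ.filter (fun D : H.ConnectedComponent => Nat.card D = t + r), c D ≤
            ∑ D ∈ Finset.univ.filter (fun D : H.ConnectedComponent => Nat.card D = t + r),
              6 * n * x ^ (t + r - 1) * (c D / M D) := by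
          refine Finset.sum_le_sum fun D hD => ?_
          have h2 := card_isoClass_mul_card_aut_le hp D
          rw [(Finset.mem_filter.1 hD).2] at h2
          have h3 : 0 < M D := by linarith [hM1 D]
          calc c D = M D * (c D / M D) := by field_simp
            _ ≤ _ := mul_le_mul_of_nonneg_right h2 (by positivity)
        refine h1.trans ?_
        rw [← Finset.mul_sum]
        have h4 := (sum_card_copy_div_le hH hT r).trans
          (Real.pow_div_factorial_le_exp _ (Nat.cast_nonneg (Nat.card τ + r)) r)
        rw [← ht, ← mul_one ((t + r : ℕ) : ℝ), Real.exp_nat_mul] at h4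
        refine (mul_le_mul_of_nonneg_left h4 (by positivity)).trans (le_of_eq ?_)
        rw [show t + r - 1 = (t - 1) + r by omega, pow_add, pow_add, mul_pow]
        ring
    _ ≤ 6 * n * x ^ (t - 1) * Real.exp 1 ^ t * 11 := by
        rw [← Finset.mul_sum]
        exact mul_le_mul_of_nonneg_left hgeom (by positivity)
    _ ≤ n * (600 * x) ^ (t - 1) := by
        -- The constant 600 comes from 6 · 11 · 3^{s+2} = 594 · 3^s.
        obtain ⟨s, hs⟩ : ∃ s, t = s + 2 := ⟨t - 2, by omega⟩
        rw [hs, show s + 2 - 1 = s + 1 by omega]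
        have h1 : Real.exp 1 ^ (s + 2) ≤ 3 ^ (s + 2) :=
          pow_le_pow_left₀ (Real.exp_pos _).le (by linarith [Real.exp_one_lt_d9]) _
        have h2 : (3 : ℝ) ^ s ≤ 600 ^ s := pow_le_pow_left₀ (by norm_num) (by norm_num) _
        have h3 : 6 * Real.exp 1 ^ (s + 2) * 11 ≤ (600 : ℝ) ^ (s + 1) := by
          have h4 : (3 : ℝ) ^ (s + 2) = 9 * 3 ^ s := by ring
          have h5 : (600 : ℝ) ^ (s + 1) = 600 * 600 ^ s := by ring
          have h6 : (0 : ℝ) ≤ 3 ^ s := by positivity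
          linarith
        calc 6 * n * x ^ (s + 1) * Real.exp 1 ^ (s + 2) * 11
            = (n * x ^ (s + 1)) * (6 * Real.exp 1 ^ (s + 2) * 11) := by ring
          _ ≤ (n * x ^ (s + 1)) * 600 ^ (s + 1) := mul_le_mul_of_nonneg_left h3 (by positivity)
          _ = _ := by rw [mul_pow]; ring

end TreeCopies

/-! ### Copies of a forest in H -/

section Forests

variable {A : Type*} [Finite A] (I : SimpleGraph A)

lemma sum_card_connectedComponent [Fintype I.ConnectedComponent] :
    ∑ C : I.ConnectedComponent, Nat.card C = Nat.card A := by
  rw [← Nat.card_sigma]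
  exact Nat.card_congr (Equiv.sigmaFiberEquiv I.connectedComponentMk)

lemma card_edgeSet_le_sum_of_isAcyclic [Fintype I.ConnectedComponent] (hI : I.IsAcyclic) :
    Nat.card I.edgeSet ≤ ∑ C : I.ConnectedComponent, (Nat.card C - 1) := by
  have h1 : ∀ C : I.ConnectedComponent, Nat.card C - 1 = Nat.card C.toSimpleGraph.edgeSet :=
    fun C => by
      have := (isTree_iff_connected_and_card.1 (hI.isTree_connectedComponent C)).2
      omega
  simp only [h1]
  rw [← Nat.card_sigma]
  refine Nat.card_le_card_of_surjective
    (fun x : Σ C : I.ConnectedComponent, C.toSimpleGraph.edgeSet =>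
      x.1.toSimpleGraph_hom.mapEdgeSet x.2) ?_
  rintro ⟨e, he⟩
  induction e with | _ a b
  have hb : b ∈ I.connectedComponentMk a := ConnectedComponent.sound he.symm.reachable
  exact ⟨⟨I.connectedComponentMk a, ⟨s(⟨a, rfl⟩, ⟨b, hb⟩), he⟩⟩, rfl⟩

variable {I} {V : Type*} [Finite V] {H : SimpleGraph V} {n : ℕ} {p : unitInterval}

lemma card_copy_le_prod [Fintype I.ConnectedComponent] :
    Nat.card (Copy I H) ≤ ∏ C : I.ConnectedComponent, Nat.card (Copy C.toSimpleGraph H) := by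
  rw [← Nat.card_pi]
  refine Nat.card_le_card_of_injective
    (fun f C => f.comp (Copy.induce I C.supp)) fun f f' h => Copy.ext fun a => ?_
  exact DFunLike.congr_fun (congrFun h (I.connectedComponentMk a)) ⟨a, rfl⟩

/-- A copy of I restricts to copies of its components, so the tree bound can be multiplied. If I has
any copy in H it is a forest, and then its edge count is at most the sum of |C| - 1 over its
components C. -/
lemma card_copy_le (hn : Nat.card V ≤ n) (hp : ∀ I : H.Subgraph, 1 / 2 ≤ expCopies n I.coe p)
    (hx : (n : ℝ) * p ≤ 1 / 3) (hp1 : 600 * (p : ℝ) ≤ 1) :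
    (Nat.card (Copy I H) : ℝ) ≤ (n : ℝ) ^ Nat.card A * (600 * (p : ℝ)) ^ Nat.card I.edgeSet := by
  classical
  have : Fintype I.ConnectedComponent := Fintype.ofFinite _
  have hp0 : (0 : ℝ) ≤ p := p.2.1
  rcases isEmpty_or_nonempty (Copy I H) with he | ⟨⟨f⟩⟩
  · rw [Nat.card_of_isEmpty, Nat.cast_zero]
    positivity
  have hI : I.IsAcyclic := (isAcyclic_of_expCopies hp hx).comap f.toHom f.injective
  calc (Nat.card (Copy I H) : ℝ)
      ≤ ∏ C : I.ConnectedComponent, (Nat.card (Copy C.toSimpleGraph H) : ℝ) := by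
        have h := card_copy_le_prod (I := I) (H := H)
        exact_mod_cast h
    _ ≤ ∏ C : I.ConnectedComponent, ((n : ℝ) ^ Nat.card C * (600 * (p : ℝ)) ^ (Nat.card C - 1)) := by
        refine Finset.prod_le_prod (fun _ _ => Nat.cast_nonneg _) fun C _ => ?_
        refine (card_copy_le_pow hn hp hx C.connected_toSimpleGraph).trans (le_of_eq ?_)
        have : Nonempty C := C.connected_toSimpleGraph.nonempty
        obtain ⟨r, hr⟩ : ∃ r, Nat.card C = r + 1 :=
          ⟨Nat.card C - 1, by have := Nat.card_pos (α := C); omega⟩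
        rw [hr, Nat.add_sub_cancel, mul_left_comm 600, mul_pow (n : ℝ), pow_succ]
        ring
    _ = (n : ℝ) ^ Nat.card A * (600 * (p : ℝ)) ^ ∑ C : I.ConnectedComponent, (Nat.card C - 1) := by
        rw [Finset.prod_mul_distrib, Finset.prod_pow_eq_pow_sum, Finset.prod_pow_eq_pow_sum,
          sum_card_connectedComponent]
    _ ≤ _ := mul_le_mul_of_nonneg_left (pow_le_pow_of_le_one (by positivity) hp1
        (card_edgeSet_le_sum_of_isAcyclic I hI)) (by positivity)

end Forests

/-! ### Spreadness of the random copy of H -/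

section Embeddings

/-- Since (n - i)/n ≥ (a - i)/a for a ≤ n, the ratio of n^a to the falling factorial is at most
a^a/a! ≤ e^a. -/
lemma pow_le_exp_mul_descFactorial {n a : ℕ} (h : a ≤ n) :
    (n : ℝ) ^ a ≤ Real.exp a * n.descFactorial a := by
  rcases Nat.eq_zero_or_pos a with rfl | ha
  · simp
  have ha' : (0 : ℝ) < a := by exact_mod_cast ha
  have h1 : n ^ a * a.factorial ≤ a ^ a * n.descFactorial a := by
    rw [← Nat.descFactorial_self, Nat.descFactorial_eq_prod_range,
      Nat.descFactorial_eq_prod_range]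
    rw [show n ^ a = ∏ _i ∈ Finset.range a, n by simp,
      show a ^ a = ∏ _i ∈ Finset.range a, a by simp,
      ← Finset.prod_mul_distrib, ← Finset.prod_mul_distrib]
    refine Finset.prod_le_prod' fun i hi => ?_
    rw [Nat.mul_sub, Nat.mul_sub, mul_comm a n]
    exact Nat.sub_le_sub_left (Nat.mul_le_mul_right i h) _
  have h2 := Real.pow_div_factorial_le_exp (a : ℝ) (Nat.cast_nonneg a) a
  have hf : (0 : ℝ) < a.factorial := by exact_mod_cast a.factorial_pos
  have h3 : (n : ℝ) ^ a * a.factorial ≤ (a : ℝ) ^ a * n.descFactorial a := by exact_mod_cast h1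
  rw [div_le_iff₀ hf] at h2
  have h4 : (0 : ℝ) ≤ n.descFactorial a := Nat.cast_nonneg _
  refine le_of_mul_le_mul_right (h3.trans ?_) hf
  calc (a : ℝ) ^ a * n.descFactorial a ≤ Real.exp a * a.factorial * n.descFactorial a :=
        mul_le_mul_of_nonneg_right h2 h4
    _ = _ := by ring

variable {V : Type*} [Fintype V] {H : SimpleGraph V} {n : ℕ}

open Classical in
/-- The embeddings of the vertices of `H` whose image contains a given set `S` of edges are
determined by a copy in `H` of the graph formed by `S` and an embedding of the other vertices. -/
lemma card_embedding_superset_le (S : Finset (Sym2 (Fin n))) (A : Finset (Fin n))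
    (hA : ∀ i, i ∈ A ↔ ∃ e ∈ S, i ∈ e) :
    Nat.card {φ : V ↪ Fin n // S ⊆ (H.map φ).edgeFinset} ≤
      Nat.card (Copy ((fromEdgeSet (S : Set (Sym2 (Fin n)))).induce (A : Set (Fin n))) H) *
        (n - A.card).descFactorial (Fintype.card V - A.card) := by
  set I := (fromEdgeSet (S : Set (Sym2 (Fin n)))).induce (A : Set (Fin n)) with hI
  have hadj : ∀ (φ : {φ : V ↪ Fin n // S ⊆ (H.map φ).edgeFinset}) {i j : Fin n},
      s(i, j) ∈ S → ∃ u v, H.Adj u v ∧ φ.1 u = i ∧ φ.1 v = j := by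
    intro φ i j hij
    have := φ.2 hij
    rw [mem_edgeFinset, mem_edgeSet, map_adj] at this
    exact this
  have hpre : ∀ φ : {φ : V ↪ Fin n // S ⊆ (H.map φ).edgeFinset},
      ∀ i : (A : Set (Fin n)), ∃ v, φ.1 v = i := by
    rintro φ ⟨i, hi⟩
    obtain ⟨e, he, hie⟩ := (hA i).1 hi
    obtain ⟨j, rfl⟩ := hie
    obtain ⟨u, -, -, hu, -⟩ := hadj φ he
    exact ⟨u, hu⟩
  choose g hg using hpre
  let c : {φ : V ↪ Fin n // S ⊆ (H.map φ).edgeFinset} → Copy I H := fun φ =>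
    ⟨⟨g φ, fun {i j} hij => by
      have h1 : s((i : Fin n), (j : Fin n)) ∈ S := hij.1
      obtain ⟨u, v, huv, hu, hv⟩ := hadj φ h1
      rw [φ.1.injective ((hg φ i).trans hu.symm), φ.1.injective ((hg φ j).trans hv.symm)]
      exact huv⟩, fun i j hij => Subtype.ext (by
        have hij' : g φ i = g φ j := hij
        rw [← hg φ i, ← hg φ j, hij'])⟩
  have hc : ∀ (φ : {φ : V ↪ Fin n // S ⊆ (H.map φ).edgeFinset}) (i : (A : Set (Fin n))),
      φ.1 (c φ i) = i := hg
  have hcard : ∀ f : Copy I H,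
      Nat.card ({v // v ∉ Set.range f} ↪ {i // i ∉ (A : Set (Fin n))}) =
        (n - A.card).descFactorial (Fintype.card V - A.card) := by
    intro f
    have h1 := Fintype.card_subtype_compl (fun v => v ∈ Set.range f)
    have h2 : Fintype.card {v // v ∈ Set.range f} = A.card := by
      rw [← Fintype.card_congr (Equiv.ofInjective f f.injective)]
      simp
    have h3 := Fintype.card_subtype_compl (fun i => i ∈ (A : Set (Fin n)))
    have h4 : Fintype.card {i // i ∈ (A : Set (Fin n))} = A.card := by simp
    rw [Nat.card_eq_fintype_card, Fintype.card_embedding_eq, h1, h2, h3, h4, Fintype.card_fin]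
  have hsig : Nat.card (Σ f : Copy I H, {v // v ∉ Set.range f} ↪ {i // i ∉ (A : Set (Fin n))}) =
      Nat.card (Copy I H) * (n - A.card).descFactorial (Fintype.card V - A.card) := by
    have : Fintype (Copy I H) := Fintype.ofFinite _
    rw [Nat.card_sigma, Finset.sum_congr rfl fun f _ => hcard f, Finset.sum_const,
      Finset.card_univ, smul_eq_mul, Nat.card_eq_fintype_card]
  rw [← hsig]
  have hout : ∀ φ (v : V), v ∉ Set.range (c φ) → φ.1 v ∉ (A : Set (Fin n)) := by
    intro φ v hv hvA
    exact hv ⟨⟨φ.1 v, hvA⟩, φ.1.injective (hc φ ⟨φ.1 v, hvA⟩)⟩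
  refine Nat.card_le_card_of_injective (fun φ => ⟨c φ, ⟨fun v => ⟨φ.1 v, hout φ v v.2⟩,
    fun v w h => Subtype.ext (φ.1.injective (congrArg Subtype.val h))⟩⟩) ?_
  intro φ ψ h
  obtain ⟨h1, h2⟩ := Sigma.mk.inj_iff.1 h
  have h3 : ∀ (f f' : Copy I H) (x : {v // v ∉ Set.range f} ↪ {i // i ∉ (A : Set (Fin n))})
      (y : {v // v ∉ Set.range f'} ↪ {i // i ∉ (A : Set (Fin n))}), f = f' → HEq x y →
      ∀ v (hv : v ∉ Set.range f) (hv' : v ∉ Set.range f'), (x ⟨v, hv⟩ : Fin n) = y ⟨v, hv'⟩ := by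
    rintro f _ x _ rfl h v hv hv'
    rw [eq_of_heq h]
  refine Subtype.ext (DFunLike.ext _ _ fun v => ?_)
  by_cases hv : v ∈ Set.range (c φ)
  · obtain ⟨i, rfl⟩ := hv
    rw [hc φ i, h1, hc ψ i]
  · exact h3 _ _ _ _ h1 h2 v hv (h1 ▸ hv)

open Classical in
/-- The uniformly random copy of `H` is spread. -/
lemma card_filter_embedding_le {p : unitInterval} (hn : Fintype.card V ≤ n)
    (hp : ∀ I : H.Subgraph, 1 / 2 ≤ expCopies n I.coe p)
    (hx : (n : ℝ) * p ≤ 1 / 3) (hp1 : 600 * (p : ℝ) ≤ 1) (S : Finset (Sym2 (Fin n))) :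
    ((Finset.univ.filter fun φ : V ↪ Fin n => S ⊆ (H.map φ).edgeFinset).card : ℝ) ≤
      Fintype.card (V ↪ Fin n) * (5400 * (p : ℝ)) ^ S.card := by
  have hp0 : (0 : ℝ) ≤ p := p.2.1
  -- A copy containing S may be assumed to exist; it shows that S has no loops and spans at most v_H
  -- vertices.
  rcases (Finset.univ.filter fun φ : V ↪ Fin n => S ⊆ (H.map φ).edgeFinset).eq_empty_or_nonempty
    with he | ⟨φ, hφ⟩
  · rw [he, Finset.card_empty, Nat.cast_zero]
    positivity
  have hφS := (Finset.mem_filter.1 hφ).2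
  set A : Finset (Fin n) := S.biUnion Sym2.toFinset with hAdef
  have hA : ∀ i, i ∈ A ↔ ∃ e ∈ S, i ∈ e := by simp [hAdef]
  have hA2 : A.card ≤ S.card * 2 := by
    refine Finset.card_biUnion_le_card_mul _ _ _ fun e _ => ?_
    rw [Sym2.card_toFinset]
    split_ifs <;> norm_num
  have hAV : A.card ≤ Fintype.card V := by
    have : A ⊆ Finset.univ.map φ := fun i hi => by
      obtain ⟨e, he, hie⟩ := (hA i).1 hi
      obtain ⟨j, rfl⟩ := hie
      have := hφS he
      rw [mem_edgeFinset, mem_edgeSet, map_adj] at this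
      obtain ⟨u, -, -, hu, -⟩ := this
      exact Finset.mem_map.2 ⟨u, Finset.mem_univ _, hu⟩
    simpa using Finset.card_le_card this
  set I := (fromEdgeSet (S : Set (Sym2 (Fin n)))).induce (A : Set (Fin n)) with hI
  have hedge : S.card ≤ Nat.card I.edgeSet := by
    rw [← Nat.card_eq_finsetCard]
    refine Nat.card_le_card_of_surjective
      (fun e : I.edgeSet => (⟨(e : Sym2 (A : Set (Fin n))).map Subtype.val, ?_⟩ : S)) ?_
    · obtain ⟨e, he⟩ := e
      induction e with | _ a b
      exact he.1
    · rintro ⟨e, he⟩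
      induction e with | _ a b
      have hne : a ≠ b := (mem_edgeSet _).1 (mem_edgeFinset.1 (hφS he)) |>.ne
      exact ⟨⟨s(⟨a, (hA a).2 ⟨_, he, Sym2.mem_mk_left a b⟩⟩,
        ⟨b, (hA b).2 ⟨_, he, Sym2.mem_mk_right a b⟩⟩), ⟨he, hne⟩⟩, rfl⟩
  have h1 := card_embedding_superset_le (H := H) S A hA
  have h2 := card_copy_le (I := I) (by rwa [Nat.card_eq_fintype_card]) hp hx hp1
  have h3 := pow_le_exp_mul_descFactorial (hAV.trans hn)
  have h4 := Nat.descFactorial_mul_descFactorial (n := n) hAV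
  have hcA : Nat.card (A : Set (Fin n)) = A.card := by simp
  rw [hcA] at h2
  rw [Nat.card_eq_fintype_card, Fintype.card_subtype] at h1
  rw [Fintype.card_embedding_eq, Fintype.card_fin, ← h4]
  -- S spans at most 2|S| vertices, so replacing n^|A| by a falling factorial costs e^{2|S|} ≤
  -- 9^|S|; hence 5400 = 9 · 600.
  have hexp : Real.exp A.card ≤ 9 ^ S.card := by
    calc Real.exp A.card ≤ Real.exp ((S.card * 2 : ℕ) : ℝ) :=
          Real.exp_le_exp.2 (by exact_mod_cast hA2)
      _ = (Real.exp 1 ^ 2) ^ S.card := by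
          rw [← pow_mul, ← Real.exp_nat_mul, mul_one, mul_comm 2]
      _ ≤ 9 ^ S.card := by
          refine pow_le_pow_left₀ (by positivity) ?_ _
          nlinarith [Real.exp_one_lt_d9, Real.exp_pos 1]
  calc _ ≤ ((Nat.card (Copy I H) * (n - A.card).descFactorial (Fintype.card V - A.card) : ℕ) : ℝ) :=
        Nat.cast_le.2 h1
    _ = (Nat.card (Copy I H) : ℝ) * (n - A.card).descFactorial (Fintype.card V - A.card) := by
        push_cast; rfl
    _ ≤ (9 ^ S.card * n.descFactorial A.card * (600 * (p : ℝ)) ^ S.card) *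
          (n - A.card).descFactorial (Fintype.card V - A.card) := by
        refine mul_le_mul_of_nonneg_right (h2.trans ?_) (Nat.cast_nonneg _)
        refine mul_le_mul (h3.trans (mul_le_mul_of_nonneg_right hexp (Nat.cast_nonneg _)))
          (pow_le_pow_of_le_one (by positivity) hp1 hedge) (by positivity) (by positivity)
    _ = _ := by
        rw [show 5400 * (p : ℝ) = 9 * (600 * p) by ring, mul_pow 9]
        push_cast
        ring

end Embeddings

/-! ### From spreadness to the threshold -/

section Threshold

variable {V : Type*} [Fintype V] {H : SimpleGraph V} {n : ℕ}

lemma pc_lt_of_half_lt (hn : Fintype.card V ≤ n) (hH : H ≠ ⊥) {r : unitInterval}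
    (hr : 1 / 2 < containProb n H r) : pc n H < r := by
  obtain ⟨p₀, hp₀, -⟩ := existsUnique_containProb_eq_half n H hn hH
  rw [← (pc_spec n H hn hH p₀).1 hp₀]
  by_contra! h
  have := monotone_containProb n H (show r ≤ p₀ from h)
  linarith

lemma containProb_one (hn : Fintype.card V ≤ n) : containProb n H 1 = 1 := by
  have : H.IsContained (⊤ : SimpleGraph (Fin n)) := by
    have f : V ↪ Fin n := (Function.Embedding.nonempty_of_card_le (by simpa using hn)).some
    exact ⟨⟨⟨fun v => f v, fun {a b} h => by simpa using h.ne⟩, f.injective⟩⟩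
  simp [containProb, measureReal_def, Measure.dirac_apply' _ (measurableSet_graph n _), this]

/-- If the number of rounds `k` is logarithmic in the number of edges of `H`, then the union of `k`
random graphs of density a constant times `p` is likely to contain a copy of `H`. -/
lemma two_thirds_le_containProb (hn : Fintype.card V ≤ n) {p : unitInterval}
    (hp : ∀ I : H.Subgraph, 1 / 2 ≤ expCopies n I.coe p) (hx : (n : ℝ) * p ≤ 1 / 3)
    (hq : 345600 * (p : ℝ) ≤ 1) {k : ℕ} (hk : Nat.card H.edgeSet < 2 ^ k) {r : unitInterval}
    (hr : (r : ℝ) = 1 - (1 - 345600 * (p : ℝ)) ^ k) : 2 / 3 ≤ containProb n H r := by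
  classical
  have hp0 : (0 : ℝ) ≤ p := p.2.1
  set u := (⊤ : SimpleGraph (Fin n)).edgeFinset with hu
  have hne : Nonempty (V ↪ Fin n) := Function.Embedding.nonempty_of_card_le (by simpa using hn)
  have hN : (0 : ℝ) < Fintype.card (V ↪ Fin n) := by exact_mod_cast Fintype.card_pos
  -- The family is indexed by all embeddings, with repetitions, and N is their number. The round
  -- density is 64 · 5400p = 345600p.
  have h := spread_fail_le u (p := 5400 * (p : ℝ)) (by positivity) (by linarith) hN.le k
    (Nat.card H.edgeSet) hk (Finset.univ : Finset (V ↪ Fin n)) (fun φ => (H.map φ).edgeFinset)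
    (fun φ _ => ⟨edgeFinset_mono le_top, by
      rw [card_edgeFinset_map, Nat.card_eq_fintype_card, ← edgeFinset_card]⟩)
    (fun S _ => card_filter_embedding_le hn hp hx (by linarith) S)
  rw [show 1 - 64 * (5400 * (p : ℝ)) = 1 - 345600 * p by ring, ← hr, Finset.card_univ] at h
  have hfail := (le_of_mul_le_mul_left h hN).trans (sum_quarter_pow_le _)
  have hcont : containProb n H r = biasedSum u r (fun S =>
      if H.IsContained (fromEdgeSet (S : Set (Sym2 (Fin n)))) then 1 else 0) :=
    containProb_eq' n H r
  have hone : (1 : ℝ) ≤ containProb n H r + biasedSum u r (fun W =>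
      if ∃ φ ∈ (Finset.univ : Finset (V ↪ Fin n)), (H.map φ).edgeFinset ⊆ W then 0 else 1) := by
    rw [hcont, ← biasedSum_add]
    refine (biasedSum_const u r 1).symm.le.trans (biasedSum_mono u r.2.1 r.2.2 fun S _ => ?_)
    by_cases hS : ∃ φ ∈ (Finset.univ : Finset (V ↪ Fin n)), (H.map φ).edgeFinset ⊆ S
    · obtain ⟨φ, -, hφ⟩ := id hS
      have : H.IsContained (fromEdgeSet (S : Set (Sym2 (Fin n)))) := by
        refine ⟨⟨⟨φ, fun {a b} hab => ?_⟩, φ.injective⟩⟩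
        rw [fromEdgeSet_adj]
        refine ⟨hφ ?_, fun h => hab.ne (φ.injective h)⟩
        rw [mem_edgeFinset, mem_edgeSet]
        exact (map_adj_apply).2 hab
      rw [if_pos this, if_pos hS, add_zero]
    · rw [if_neg hS]
      split_ifs <;> norm_num
  linarith

end Threshold

end KahnKalai

theorem theorem1p3 :
    ∃ K : ℝ, ∀ (n : ℕ) (V : Type*) [Fintype V] (H : SimpleGraph V),
      Fintype.card V ≤ n → H ≠ ⊥ →
      KahnKalai.pE n H < 1 / (3 * (n : ℝ)) →
      KahnKalai.pc n H < K * KahnKalai.pE n H * Real.logb 2 (Fintype.card V) := by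
  -- The constant is 4 · 345600: at most 4 log₂ v_H rounds, each of density 345600p.
  refine ⟨1382400, fun n V _ H hn hH hpE => ?_⟩
  classical
  obtain ⟨p, hpeq, hp⟩ := (KahnKalai.isLeast_pE n H hn).1
  rw [← hpeq] at hpE ⊢
  have hp0 : (0 : ℝ) ≤ p := p.2.1
  obtain ⟨a, b, hab⟩ := SimpleGraph.ne_bot_iff_exists_adj.1 hH
  have hv : 2 ≤ Fintype.card V := Fintype.one_lt_card_iff.2 ⟨a, b, hab.ne⟩
  have hn0 : (0 : ℝ) < n := by
    have : 0 < n := by omega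
    exact_mod_cast this
  have hx : (n : ℝ) * p ≤ 1 / 3 := by
    rw [lt_div_iff₀ (by positivity)] at hpE
    linarith
  -- The factor 2 is there because H may have up to about v_H² edges as far as this bound is
  -- concerned.
  set k := 2 * (Nat.log 2 (Fintype.card V) + 1) with hk
  have hkv : Nat.card H.edgeSet < 2 ^ k := by
    have h1 : Nat.card H.edgeSet ≤ (Fintype.card V).choose 2 := by
      rw [Nat.card_eq_fintype_card, ← SimpleGraph.edgeFinset_card]
      exact SimpleGraph.card_edgeFinset_le_card_choose_two
    have h2 : (Fintype.card V).choose 2 ≤ Fintype.card V ^ 2 := Nat.choose_le_pow _ _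
    have h3 : Fintype.card V < 2 ^ (Nat.log 2 (Fintype.card V) + 1) :=
      Nat.lt_pow_succ_log_self (by norm_num) _
    rw [hk, mul_comm, pow_mul]
    exact (h1.trans h2).trans_lt (Nat.pow_lt_pow_left h3 (by norm_num))
  have hklog : (k : ℝ) ≤ 4 * Real.logb 2 (Fintype.card V) := by
    have h1 := Real.natLog_le_logb (Fintype.card V) 2
    have h2 : 1 ≤ Real.logb 2 (Fintype.card V) := by
      rw [Real.le_logb_iff_rpow_le (by norm_num) (by positivity), Real.rpow_one]
      exact_mod_cast hv
    rw [hk]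
    push_cast at h1 ⊢
    linarith
  have hkK : 345600 * (p : ℝ) * k ≤ 1382400 * p * Real.logb 2 (Fintype.card V) := by
    have := mul_le_mul_of_nonneg_left hklog (by positivity : 0 ≤ 345600 * (p : ℝ))
    linarith
  refine lt_of_lt_of_le ?_ hkK
  -- If the claimed bound is at least 1, it suffices that p_c < 1. Otherwise the density per round
  -- is less than 1 and the rounds make sense.
  rcases le_or_gt 1 (345600 * (p : ℝ) * k) with h1 | h1
  · refine lt_of_lt_of_le (KahnKalai.pc_lt_of_half_lt (r := 1) hn hH ?_) h1
    rw [KahnKalai.containProb_one hn]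
    norm_num
  · have hk1 : (1 : ℝ) ≤ k := by
      have : 1 ≤ k := by omega
      exact_mod_cast this
    have hq : 345600 * (p : ℝ) ≤ 1 := by nlinarith
    have hpow0 : 0 ≤ (1 - 345600 * (p : ℝ)) ^ k := pow_nonneg (by linarith) k
    have hpow1 : (1 - 345600 * (p : ℝ)) ^ k ≤ 1 := pow_le_one₀ (by linarith) (by linarith)
    let r : unitInterval := ⟨1 - (1 - 345600 * (p : ℝ)) ^ k, by linarith, by linarith⟩
    have h2 := KahnKalai.two_thirds_le_containProb (r := r) hn hp hx hq hkv rfl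
    have h3 := KahnKalai.pc_lt_of_half_lt hn hH (r := r) (by linarith)
    refine h3.trans_le ?_
    -- Bernoulli: the union of k rounds has density at most k times that of one round.
    have h4 := one_add_mul_le_pow (a := -(345600 * (p : ℝ))) (by linarith) k
    rw [← sub_eq_add_neg] at h4
    simp only [r]
    linarith
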